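/- Let $G=(V,E)$ be an undirected graph, possibly with multiple edges, with $n=|V|$ and $m=|E|$, and let $S,T\subseteq V$ be disjoint. An $(S,T)$-cut is a set $X\subseteq E$ such that no path of $G\setminus X=(V,E\setminus X)$ connects a vertex of $S$ with a vertex of $T$; it is minimum if no $(S,T)$-cut has fewer edges. Let $p$ be the size of the minimum $(S,T)$-cuts. There are one algorithm and one constant $C$ such that, for every input $(G,S,T)$, the algorithm computes the number of minimum $(S,T)$-cuts, in time at most $$C\cdot 2^{p(p+2)}\,p\,m\,n^3 ,$$ where a factor $p$, $m$ or $n$ that is $0$ is to be read as $1$ (this matters only if $p=0$, that is, if no path connects $S$ with $T$). Time is the number of steps of a random access machine with uniform cost, whose operations on natural numbers are addition, truncated subtraction, indirect access to memory and the test for zero. In particular, counting minimum $(S,T)$-cuts is fixed-parameter tractable with respect to $p$: one algorithm solves it in time at most $f(p)\,P(n+m)$ for a computable function $f$ and a polynomial $P$. -/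

import Mathlib

open scoped Graph

/-! ## Cuts in multigraphs -/

namespace Graph

variable {α β : Type*}

/-- `y` can be reached from `x` by a path of `G`. -/
def Reaches (G : Graph α β) (x y : α) : Prop :=
  Relation.ReflTransGen G.Adj x y

/-- A set `X` of edges of `G` is an `(S, T)`-cut if no path of `G \ X` connects a vertex of `S`
with a vertex of `T`. -/
def IsCut (G : Graph α β) (S T : Set α) (X : Set β) : Prop :=
  X ⊆ E(G) ∧ ∀ s ∈ S, ∀ t ∈ T, ¬ (G.deleteEdges X).Reaches s t

/-- An `(S, T)`-cut is minimum if no `(S, T)`-cut has fewer edges. -/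
def IsMinCut (G : Graph α β) (S T : Set α) (X : Set β) : Prop :=
  G.IsCut S T X ∧ ∀ Y, G.IsCut S T Y → X.encard ≤ Y.encard

end Graph

/-! ## Instances of the counting problem -/

/-- An instance: an undirected multigraph with `n` vertices and `m` edges, given by the list of the
endpoints of its edges, and two disjoint sets `S` (sources) and `T` (targets) of vertices. The order
of the two endpoints of an edge has no meaning. Simple graphs are the instances without loops and
without two edges that have the same endpoints. -/
structure CutInstance where
  /-- number of vertices -/
  n : ℕ
  /-- number of edges -/
  m : ℕ
  /-- first endpoint of an edge -/
  fst : Fin m → Fin n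
  /-- second endpoint of an edge -/
  snd : Fin m → Fin n
  /-- sources -/
  S : Finset (Fin n)
  /-- targets -/
  T : Finset (Fin n)
  disjoint : Disjoint S T

namespace CutInstance

/-- The undirected multigraph of an instance. -/
def graph (I : CutInstance) : Graph (Fin I.n) (Fin I.m) where
  vertexSet := Set.univ
  edgeSet := Set.univ
  IsLink e x y := (I.fst e = x ∧ I.snd e = y) ∨ (I.fst e = y ∧ I.snd e = x)
  isLink_symm := by
    intro e _
    exact ⟨fun _ _ h => h.symm⟩
  eq_or_eq_of_isLink_of_isLink := by
    rintro e x y v w (⟨rfl, rfl⟩ | ⟨rfl, rfl⟩) (⟨rfl, rfl⟩ | ⟨rfl, rfl⟩) <;> simp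
  edge_mem_iff_exists_isLink := by
    intro e
    exact ⟨fun _ => ⟨I.fst e, I.snd e, Or.inl ⟨rfl, rfl⟩⟩, fun _ => Set.mem_univ e⟩
  left_mem_of_isLink := by
    intro e x y _
    exact Set.mem_univ x

/-- The size of the minimum `(S, T)`-cuts. -/
noncomputable def minCutSize (I : CutInstance) : ℕ :=
  sInf {k | ∃ X : Set (Fin I.m), I.graph.IsCut I.S I.T X ∧ X.ncard = k}

/-- The number of minimum `(S, T)`-cuts. -/
noncomputable def numMinCuts (I : CutInstance) : ℕ :=
  {X : Set (Fin I.m) | I.graph.IsMinCut I.S I.T X}.ncard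

end CutInstance

/-! ## A random access machine with uniform cost

A program uses finitely many registers and finitely many arrays of natural numbers. The operations
are addition, truncated subtraction and (indirect) access to the arrays; each of them, each constant
or register that is read, each assignment and each test costs one step. There is no multiplication,
no division and no bitwise operation. -/

namespace RAM

/-- The contents of the registers and of the arrays. -/
structure State where
  /-- `reg i` is the content of register `i` -/
  reg : ℕ → ℕ
  /-- `arr a j` is the entry of index `j` of array `a` -/
  arr : ℕ → ℕ → ℕ

/-- Expressions. -/
inductive Expr : Type
  | const (c : ℕ)
  | reg (i : ℕ)
  | load (a : ℕ) (e : Expr)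
  | add (e₁ e₂ : Expr)
  | sub (e₁ e₂ : Expr)

/-- The value of an expression. -/
def Expr.eval (σ : State) : Expr → ℕ
  | .const c => c
  | .reg i => σ.reg i
  | .load a e => σ.arr a (e.eval σ)
  | .add e₁ e₂ => e₁.eval σ + e₂.eval σ
  | .sub e₁ e₂ => e₁.eval σ - e₂.eval σ

/-- The number of steps of the evaluation of an expression. -/
def Expr.cost : Expr → ℕ
  | .const _ => 1
  | .reg _ => 1
  | .load _ e => e.cost + 1
  | .add e₁ e₂ => e₁.cost + e₂.cost + 1
  | .sub e₁ e₂ => e₁.cost + e₂.cost + 1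

/-- Programs. -/
inductive Prog : Type
  | skip
  | set (i : ℕ) (e : Expr)
  | store (a : ℕ) (j e : Expr)
  | seq (P Q : Prog)
  | ite (e : Expr) (P Q : Prog)
  | loop (e : Expr) (P : Prog)

/-- The state after the assignment of `v` to register `i`. -/
def State.setReg (σ : State) (i v : ℕ) : State :=
  { σ with reg := Function.update σ.reg i v }

/-- The state after the assignment of `v` to the entry of index `j` of array `a`. -/
def State.setArr (σ : State) (a j v : ℕ) : State :=
  { σ with arr := Function.update σ.arr a (Function.update (σ.arr a) j v) }

/-- `Exec P σ t τ`: program `P`, started in state `σ`, halts after exactly `t` steps in state `τ`.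
Tests succeed on nonzero values; `loop e P` repeats `P` while `e` is nonzero. -/
inductive Exec : Prog → State → ℕ → State → Prop
  | skip (σ : State) : Exec .skip σ 1 σ
  | set (σ : State) (i : ℕ) (e : Expr) :
      Exec (.set i e) σ (e.cost + 1) (σ.setReg i (e.eval σ))
  | store (σ : State) (a : ℕ) (j e : Expr) :
      Exec (.store a j e) σ (j.cost + e.cost + 1) (σ.setArr a (j.eval σ) (e.eval σ))
  | seq {P Q : Prog} {σ τ ρ : State} {t u : ℕ} (hP : Exec P σ t τ) (hQ : Exec Q τ u ρ) :
      Exec (.seq P Q) σ (t + u) ρ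
  | ite_true {e : Expr} {P Q : Prog} {σ τ : State} {t : ℕ} (he : e.eval σ ≠ 0)
      (hP : Exec P σ t τ) : Exec (.ite e P Q) σ (e.cost + 1 + t) τ
  | ite_false {e : Expr} {P Q : Prog} {σ τ : State} {t : ℕ} (he : e.eval σ = 0)
      (hQ : Exec Q σ t τ) : Exec (.ite e P Q) σ (e.cost + 1 + t) τ
  | loop_done {e : Expr} {P : Prog} {σ : State} (he : e.eval σ = 0) :
      Exec (.loop e P) σ (e.cost + 1) σ
  | loop_step {e : Expr} {P : Prog} {σ τ ρ : State} {t u : ℕ} (he : e.eval σ ≠ 0)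
      (hP : Exec P σ t τ) (hL : Exec (.loop e P) τ u ρ) :
      Exec (.loop e P) σ (e.cost + 1 + t + u) ρ

/-- Program `P`, started in state `σ`, halts after at most `t` steps with the value `out` in
register `0`. -/
def Outputs (P : Prog) (σ : State) (out t : ℕ) : Prop :=
  ∃ (u : ℕ) (τ : State), Exec P σ u τ ∧ u ≤ t ∧ τ.reg 0 = out

end RAM

/-- The initial state on an instance: registers `0` and `1` hold the numbers of vertices and of
edges, arrays `0` and `1` the first and second endpoints of the edges, arrays `2` and `3` the
characteristic functions of `S` and of `T`; everything else is zero. -/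
def CutInstance.input (I : CutInstance) : RAM.State where
  reg i := if i = 0 then I.n else if i = 1 then I.m else 0
  arr a j :=
    if a = 0 then (if h : j < I.m then (I.fst ⟨j, h⟩ : ℕ) else 0)
    else if a = 1 then (if h : j < I.m then (I.snd ⟨j, h⟩ : ℕ) else 0)
    else if a = 2 then (if h : j < I.n then (if (⟨j, h⟩ : Fin I.n) ∈ I.S then 1 else 0) else 0)
    else if a = 3 then (if h : j < I.n then (if (⟨j, h⟩ : Fin I.n) ∈ I.T then 1 else 0) else 0)
    else 0

/-- A counting problem, whose answer on the instance `I` is `ans I`, is fixed-parameter tractable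
for the parameter `param` if one program answers every instance `I`, presented as `input I`, in time
at most `f (param I) * p (size I)` for a computable function `f` and a polynomial `p`. -/
def IsFPT {ι : Type*} (input : ι → RAM.State) (ans size param : ι → ℕ) : Prop :=
  ∃ (P : RAM.Prog) (f : ℕ → ℕ) (p : Polynomial ℕ), Computable f ∧
    ∀ I : ι, RAM.Outputs P (input I) (ans I) (f (param I) * p.eval (size I))

/-! ## Flows in networks of paired arcs -/

/-! Every edge becomes two opposite arcs of capacity one, and a flow with residual capacities `r`
sends `1 - r a` along `a`. Call a vertex set closed if no residual arc leaves it. The flow value is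
the net flow across any separating set `W` (`IsFlow.val_eq`), so the number of arcs in `out W` is at
least the value, with equality exactly if `W` is closed (`IsFlow.closed_iff_card`). Once a flow with
a closed separating set is known, the minimum cuts are therefore the edge sets that leave closed
separating sets (`isMinCut_iff`). Different closed sets may have the same leaving arcs, so the arc
sets `out W` are counted, not the sets `W` (`numMinCuts_eq`).

These arc sets are counted while a closed set `U` grows from the set reachable from the sources to
the largest closed separating set. Each time `U` is enlarged to a closed set `V` such that a closed
set containing the sources, inside `V` but not inside `U`, contains all of `V \ U`. Such blocks are
the classes of vertices with the same `reach`, and treating vertices in the order of the size of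
`reach` produces them (`runs_tryVertex`). Let `J` be the arcs of `out U` that are not in `out V`,
and `O` those of `out V` that are not in `out U`. The cuts for `V` are the cuts `X` for `U` together
with the sets `X \ J ∪ O` for those `X` that contain `J` (`cuts_step`).

Whether `J ⊆ X` depends only on the trace of `X` on `D = out U`, which has `p` arcs. Hence it
suffices to store, for each of the `2 ^ p` traces, the number of cuts with that trace. Since `out U`
and `out V` have equal size, so have `J` and `O`; the arcs of `O` take over the bits of `J`, and the
new table is the sum of two tables (`table_step`): in one the bits of `J` are forgotten, in the
other they are required. At the end the entries are summed.

The maximum flow is found by augmenting paths, at most `p` times. About `n ^ 2` vertex trials, each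
with one search and at most one pass over the arcs and the table, give order `2 ^ p * m * n ^ 3`,
which is within the claimed bound. -/

/-- A network whose arcs `0, …, A - 1` come in pairs of opposite arcs, with sources and targets. -/
structure Network where
  n : ℕ
  A : ℕ
  tl : ℕ → ℕ
  hd : ℕ → ℕ
  rev : ℕ → ℕ
  S : Finset ℕ
  T : Finset ℕ
  tl_lt : ∀ a < A, tl a < n
  rev_lt : ∀ a < A, rev a < A
  rev_rev : ∀ a < A, rev (rev a) = a
  rev_ne : ∀ a < A, rev a ≠ a
  tl_rev : ∀ a < A, tl (rev a) = hd a
  S_sub : S ⊆ Finset.range n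
  disj : Disjoint S T

namespace Network

variable (N : Network)

lemma hd_rev {a : ℕ} (ha : a < N.A) : N.hd (N.rev a) = N.tl a := by
  rw [← N.tl_rev _ (N.rev_lt a ha), N.rev_rev a ha]

lemma hd_lt {a : ℕ} (ha : a < N.A) : N.hd a < N.n := by
  rw [← N.tl_rev a ha]; exact N.tl_lt _ (N.rev_lt a ha)

/-- The arcs that leave a set of vertices. -/
def out (U : Finset ℕ) : Finset ℕ :=
  (Finset.range N.A).filter fun a => N.tl a ∈ U ∧ N.hd a ∉ U

lemma mem_out {U : Finset ℕ} {a : ℕ} : a ∈ N.out U ↔ a < N.A ∧ N.tl a ∈ U ∧ N.hd a ∉ U := by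
  simp [out]

/-- A set of vertices that no residual arc leaves. -/
def Closed (r : ℕ → ℕ) (U : Finset ℕ) : Prop :=
  ∀ a < N.A, r a ≠ 0 → N.tl a ∈ U → N.hd a ∈ U

/-- The net flow out of a vertex; the flow on the arc `a` is `1 - r a`. -/
def net (r : ℕ → ℕ) (v : ℕ) : ℤ :=
  ∑ a ∈ Finset.range N.A with N.tl a = v, (1 - (r a : ℤ))

/-- The residual capacities of opposite arcs sum to `2`. -/
def Balanced (r : ℕ → ℕ) : Prop :=
  ∀ a < N.A, r a + r (N.rev a) = 2

/-- The net flow out of the sources. -/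
def val (r : ℕ → ℕ) : ℤ := ∑ v ∈ N.S, N.net r v

/-- The residual capacities `r` are those of a flow from the sources to the targets. -/
structure IsFlow (r : ℕ → ℕ) : Prop where
  balanced : N.Balanced r
  conserve : ∀ v, v ∉ N.S → v ∉ N.T → N.net r v = 0

/-- The sets of vertices that separate the sources from the targets. -/
structure Separates (U : Finset ℕ) : Prop where
  source : N.S ⊆ U
  target : Disjoint U N.T

variable {N} {r : ℕ → ℕ} {U W : Finset ℕ}

/-- The flow is antisymmetric under `rev` because opposite capacities sum to `2`, so the arcs with
both ends in `U` cancel and only those that leave `U` remain. -/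
lemma sum_net (hr : N.Balanced r) (U : Finset ℕ) :
    ∑ v ∈ U, N.net r v = ∑ a ∈ N.out U, (1 - (r a : ℤ)) := by
  classical
  have h1 : ∑ v ∈ U, N.net r v = ∑ a ∈ Finset.range N.A with N.tl a ∈ U, (1 - (r a : ℤ)) := by
    unfold net
    rw [← Finset.sum_biUnion]
    · congr 1
      ext a
      simp only [Finset.mem_biUnion, Finset.mem_filter]
      constructor
      · rintro ⟨v, hv, h, rfl⟩; exact ⟨h, hv⟩
      · rintro ⟨h, hv⟩; exact ⟨_, hv, h, rfl⟩
    · intro x _ y _ hxy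
      simp only [Function.onFun]
      rw [Finset.disjoint_left]
      intro a ha hb
      simp only [Finset.mem_filter] at ha hb
      exact hxy (ha.2.symm.trans hb.2)
  have h2 : ∑ a ∈ Finset.range N.A with N.tl a ∈ U ∧ N.hd a ∈ U, (1 - (r a : ℤ)) = 0 := by
    have : ∑ a ∈ Finset.range N.A with N.tl a ∈ U ∧ N.hd a ∈ U, (1 - (r a : ℤ)) =
        ∑ a ∈ Finset.range N.A with N.tl a ∈ U ∧ N.hd a ∈ U, -(1 - (r a : ℤ)) := by
      refine Finset.sum_nbij' N.rev N.rev ?_ ?_ ?_ ?_ ?_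
      · intro a ha
        simp only [Finset.mem_filter, Finset.mem_range] at ha ⊢
        rw [N.tl_rev a ha.1, N.hd_rev ha.1]
        exact ⟨N.rev_lt a ha.1, ha.2.2, ha.2.1⟩
      · intro a ha
        simp only [Finset.mem_filter, Finset.mem_range] at ha ⊢
        rw [N.tl_rev a ha.1, N.hd_rev ha.1]
        exact ⟨N.rev_lt a ha.1, ha.2.2, ha.2.1⟩
      · intro a ha
        simp only [Finset.mem_filter, Finset.mem_range] at ha
        exact N.rev_rev a ha.1
      · intro a ha
        simp only [Finset.mem_filter, Finset.mem_range] at ha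
        exact N.rev_rev a ha.1
      · intro a ha
        simp only [Finset.mem_filter, Finset.mem_range] at ha
        have := hr a ha.1
        omega
    rw [Finset.sum_neg_distrib] at this
    omega
  rw [h1, ← Finset.sum_filter_add_sum_filter_not _ (fun a => N.hd a ∈ U), Finset.filter_filter,
    Finset.filter_filter, h2, zero_add, out]

lemma IsFlow.val_eq (hr : N.IsFlow r) (hU : N.Separates U) :
    N.val r = ∑ a ∈ N.out U, (1 - (r a : ℤ)) := by
  rw [← sum_net hr.balanced, val]
  refine Finset.sum_subset hU.source fun v hv hS => ?_
  exact hr.conserve v hS (Finset.disjoint_left.1 hU.target hv)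

lemma IsFlow.val_le (hr : N.IsFlow r) (hU : N.Separates U) : N.val r ≤ (N.out U).card := by
  rw [hr.val_eq hU, Finset.card_eq_sum_ones]
  push_cast
  exact Finset.sum_le_sum fun a _ => by omega

lemma closed_iff : N.Closed r U ↔ ∀ a ∈ N.out U, r a = 0 := by
  simp only [Closed, mem_out]
  constructor
  · rintro h a ⟨h1, h2, h3⟩
    by_contra h4
    exact h3 (h a h1 h4 h2)
  · intro h a h1 h2 h3
    by_contra h4
    exact h2 (h a ⟨h1, h3, h4⟩)

/-- Each arc of `out U` carries at most one unit, so equality of the sums forces every term to be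
`1`, that is, `r a = 0`. This is complementary slackness. -/
lemma IsFlow.closed_iff_card (hr : N.IsFlow r) (hU : N.Separates U) :
    N.Closed r U ↔ ((N.out U).card : ℤ) = N.val r := by
  rw [hr.val_eq hU, closed_iff, Finset.card_eq_sum_ones]
  push_cast
  rw [eq_comm, Finset.sum_eq_sum_iff_of_le (fun a _ => by omega)]
  exact forall₂_congr fun a _ => by omega

/-- The residual capacities after one unit is sent along the arc `a`. -/
def push (N : Network) (r : ℕ → ℕ) (a : ℕ) : ℕ → ℕ :=
  Function.update (Function.update r a (r a - 1)) (N.rev a) (r (N.rev a) + 1)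

lemma push_apply {a : ℕ} (b : ℕ) : N.push r a b =
    if b = N.rev a then r (N.rev a) + 1 else if b = a then r a - 1 else r b := by
  simp [push, Function.update_apply]

lemma Balanced.push (hr : N.Balanced r) {a : ℕ} (ha : a < N.A) (h : r a ≠ 0) :
    N.Balanced (N.push r a) := by
  intro b hb
  have h1 := hr a ha
  have h2 := N.rev_rev a ha
  have h3 := N.rev_ne a ha
  have h4 := hr b hb
  have h5 := N.rev_rev b hb
  have h6 := N.rev_ne b hb
  simp only [push_apply]
  by_cases hba : b = a
  · subst hba
    simp [h3.symm]; omega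
  · by_cases hbr : b = N.rev a
    · subst hbr
      rw [h2] at *
      simp [h6]
      try omega
    · have h7 : N.rev b ≠ N.rev a := fun e => hba (by rw [← h5, e, h2])
      have h8 : N.rev b ≠ a := fun e => hbr (by rw [← h5, e])
      simp [hba, hbr, h7, h8, h4]

lemma net_push {a : ℕ} (ha : a < N.A) (h : r a ≠ 0) (v : ℕ) :
    N.net (N.push r a) v =
      N.net r v + (if N.tl a = v then 1 else 0) - (if N.hd a = v then 1 else 0) := by
  have key : ∀ b, (1 - (N.push r a b : ℤ)) =
      (1 - (r b : ℤ)) + (if b = a then 1 else 0) - (if b = N.rev a then 1 else 0) := by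
    intro b
    have h3 := N.rev_ne a ha
    rw [push_apply]
    by_cases hb : b = a
    · subst hb
      simp [h3.symm]; omega
    · by_cases hb' : b = N.rev a
      · subst hb'
        simp [h3]
      · simp [hb, hb']
  unfold net
  simp only [key, Finset.sum_sub_distrib, Finset.sum_add_distrib]
  simp only [Finset.sum_ite_eq', Finset.mem_filter, Finset.mem_range, ha, N.rev_lt a ha, true_and,
    N.tl_rev a ha]

/-! ## The cuts of a maximum flow -/

open Classical in
/-- The sets `out W` for the closed sets `W` between the sources and `U`. -/
noncomputable def cuts (N : Network) (r : ℕ → ℕ) (U : Finset ℕ) : Finset (Finset ℕ) :=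
  (U.powerset.filter fun W => N.S ⊆ W ∧ N.Closed r W).image N.out

lemma mem_cuts {X : Finset ℕ} :
    X ∈ N.cuts r U ↔ ∃ W, W ⊆ U ∧ N.S ⊆ W ∧ N.Closed r W ∧ N.out W = X := by
  classical
  simp [cuts, and_assoc]

lemma Closed.inter (hU : N.Closed r U) (hW : N.Closed r W) : N.Closed r (U ∩ W) := by
  intro a ha h hm
  simp only [Finset.mem_inter] at hm ⊢
  exact ⟨hU a ha h hm.1, hW a ha h hm.2⟩

lemma Closed.union (hU : N.Closed r U) (hW : N.Closed r W) : N.Closed r (U ∪ W) := by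
  intro a ha h hm
  simp only [Finset.mem_union] at hm ⊢
  exact hm.imp (hU a ha h) (hW a ha h)

section Step

variable {V : Finset ℕ}

lemma rev_residual (hr : N.Balanced r) {a : ℕ} (ha : a < N.A) (h : r a = 0) :
    r (N.rev a) ≠ 0 := by
  have := hr a ha; omega

/-- No arc outside `out V` leads from `V \ U` to the closed set `U` unless its opposite is in
`out U \ out V`. -/
lemma mem_entering {a : ℕ} (ha : a < N.A)
    (h1 : N.tl a ∈ V \ U) (h2 : N.hd a ∈ U) : N.rev a ∈ N.out U \ N.out V := by
  simp only [Finset.mem_sdiff, mem_out, N.tl_rev a ha, N.hd_rev ha] at *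
  exact ⟨⟨N.rev_lt a ha, h2, h1.2⟩, fun h => h.2.2 h1.1⟩

/-- An arc from `U` into the block `V \ U` is saturated because `U` is closed, so its opposite is
residual. Adding the block to `W` thus forces the tails of all these arcs into `W`. Conversely, a
residual arc from the block stays in `V`, and if it ends in `U` its opposite is one of these arcs
and starts in `W`. -/
lemma closed_union_sdiff_iff (hr : N.Balanced r) (hU : N.Closed r U) (hV : N.Closed r V)
    (hUV : U ⊆ V) (hW : N.Closed r W) (hWU : W ⊆ U) :
    N.Closed r (W ∪ V \ U) ↔ N.out U \ N.out V ⊆ N.out W := by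
  constructor
  · intro h a ha
    simp only [Finset.mem_sdiff, mem_out, not_and, not_not] at ha ⊢
    obtain ⟨⟨h1, h2, h3⟩, h4⟩ := ha
    refine ⟨h1, ?_, fun h5 => h3 (hWU h5)⟩
    have h5 := h4 h1 (hUV h2)
    have h6 : r a = 0 := closed_iff.1 hU a (N.mem_out.2 ⟨h1, h2, h3⟩)
    have := h _ (N.rev_lt a h1) (rev_residual hr h1 h6)
      (by rw [N.tl_rev a h1]; simp [h3, h5])
    rw [N.hd_rev h1] at this
    simpa [h2] using this
  · intro h a ha h0 hm
    rcases Finset.mem_union.1 hm with h1 | h1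
    · exact Finset.mem_union_left _ (hW a ha h0 h1)
    · have h2 := hV a ha h0 (Finset.mem_sdiff.1 h1).1
      by_cases h3 : N.hd a ∈ U
      · have h4 := h (mem_entering ha h1 h3)
        rw [mem_out, N.tl_rev a ha] at h4
        exact Finset.mem_union_left _ h4.2.1
      · exact Finset.mem_union_right _ (Finset.mem_sdiff.2 ⟨h2, h3⟩)

/-- The arcs between `U` and the block all start in `W`, so adding the block absorbs exactly these
arcs, and no arc leads from the block to `U \ W`. -/
lemma out_union_sdiff (hUV : U ⊆ V) (hWU : W ⊆ U) (h : N.out U \ N.out V ⊆ N.out W) :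
    N.out (W ∪ V \ U) = N.out W \ (N.out U \ N.out V) ∪ N.out V \ N.out U := by
  ext a
  by_cases ha : a < N.A
  swap
  · simp [mem_out, ha]
  have e1 : N.tl a ∈ V \ U → N.hd a ∈ U → N.hd a ∈ W := by
    intro h1 h2
    have := h (mem_entering ha h1 h2)
    rw [mem_out, N.tl_rev a ha] at this
    exact this.2.1
  simp only [mem_out, ha, Finset.mem_union, Finset.mem_sdiff, true_and] at e1 ⊢
  have h1 := @hWU (N.tl a)
  have h2 := @hWU (N.hd a)
  have h3 := @hUV (N.tl a)
  have h4 := @hUV (N.hd a)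
  tauto

/-- By `hblock` the block is indivisible: a closed `W` that is not inside `U` is `W ∩ U` together
with the whole block, and `closed_union_sdiff_iff` tells which closed subsets of `U` extend in this
way. -/
lemma cuts_step (hr : N.Balanced r) (hU : N.Closed r U) (hV : N.Closed r V)
    (hUV : U ⊆ V) (hSU : N.S ⊆ U)
    (hblock : ∀ W, N.Closed r W → N.S ⊆ W → W ⊆ V → ¬ W ⊆ U → V \ U ⊆ W) :
    N.cuts r V = N.cuts r U ∪ ((N.cuts r U).filter fun X => N.out U \ N.out V ⊆ X).image
      fun X => X \ (N.out U \ N.out V) ∪ N.out V \ N.out U := by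
  ext X
  simp only [Finset.mem_union, Finset.mem_image, Finset.mem_filter, mem_cuts]
  constructor
  · rintro ⟨W, hWV, hSW, hW, rfl⟩
    by_cases hWU : W ⊆ U
    · exact Or.inl ⟨W, hWU, hSW, hW, rfl⟩
    · right
      have hB := hblock W hW hSW hWV hWU
      have hc : N.Closed r (W ∩ U) := hW.inter hU
      have e : W = W ∩ U ∪ V \ U := by
        ext x
        have := @hWV x
        have := @hB x
        simp only [Finset.mem_union, Finset.mem_inter, Finset.mem_sdiff] at *
        tauto
      have hsub := (closed_union_sdiff_iff hr hU hV hUV hc Finset.inter_subset_right).1 (e ▸ hW)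
      refine ⟨N.out (W ∩ U), ⟨⟨W ∩ U, Finset.inter_subset_right, Finset.subset_inter hSW hSU, hc,
        rfl⟩, hsub⟩, ?_⟩
      rw [← out_union_sdiff hUV Finset.inter_subset_right hsub, ← e]
  · rintro (⟨W, hWU, hSW, hW, rfl⟩ | ⟨_, ⟨⟨W, hWU, hSW, hW, rfl⟩, hsub⟩, rfl⟩)
    · exact ⟨W, hWU.trans hUV, hSW, hW, rfl⟩
    · refine ⟨W ∪ V \ U, ?_, hSW.trans Finset.subset_union_left,
        (closed_union_sdiff_iff hr hU hV hUV hW hWU).2 hsub, out_union_sdiff hUV hWU hsub⟩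
      exact Finset.union_subset (hWU.trans hUV) Finset.sdiff_subset

/-- An arc that leaves `V` but not `U` starts in the block, whereas the arcs of `X` start in `U`. -/
lemma disjoint_of_mem_cuts (hUV : U ⊆ V) {X : Finset ℕ} (hX : X ∈ N.cuts r U) :
    Disjoint X (N.out V \ N.out U) := by
  obtain ⟨W, hWU, -, -, rfl⟩ := mem_cuts.1 hX
  rw [Finset.disjoint_left]
  intro a h1 h2
  simp only [Finset.mem_sdiff, mem_out] at h1 h2
  exact h2.2 ⟨h1.1, hWU h1.2.1, fun h => h2.1.2.2 (hUV h)⟩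

end Step

end Network

/-! ## Tables of the cuts indexed by binary codes -/

/-- The total weight of the elements of `X` in `D`. -/
def code (w : ℕ → ℕ) (D X : Finset ℕ) : ℕ := ∑ e ∈ X ∩ D, w e

/-- The weights of the elements of `D` are distinct powers of two below `2 ^ k`. -/
def BinaryWeights (w : ℕ → ℕ) (D : Finset ℕ) (k : ℕ) : Prop :=
  ∃ l : ℕ → ℕ, (∀ e ∈ D, w e = 2 ^ l e ∧ l e < k) ∧ Set.InjOn l D

/-- The number of members of `𝒳` with code `i` that contain `J`. -/
def table (𝒳 : Finset (Finset ℕ)) (w : ℕ → ℕ) (D J : Finset ℕ) (i : ℕ) : ℕ :=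
  (𝒳.filter fun X => J ⊆ X ∧ code w D X = i).card

lemma testBit_sum_two_pow (s : Finset ℕ) (i : ℕ) :
    (∑ j ∈ s, 2 ^ j).testBit i = true ↔ i ∈ s := by
  rw [← Nat.mem_bitIndices, ← List.mem_toFinset, Finset.toFinset_bitIndices_sum_two_pow]

/-- The machine has no division or bitwise operation. In this form a bit can be tested by a counter
modulo twice the weight. -/
lemma testBit_iff_le_mod (x l : ℕ) : x.testBit l = true ↔ ¬ x % (2 ^ l + 2 ^ l) < 2 ^ l := by
  rw [Nat.testBit_eq_decide_div_mod_eq, decide_eq_true_eq, ← two_mul, mul_comm, Nat.mod_mul]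
  have h1 := Nat.mod_lt x (Nat.two_pow_pos l)
  have h2 := Nat.mod_lt (x / 2 ^ l) (two_pos)
  rcases Nat.mod_two_eq_zero_or_one (x / 2 ^ l) with h | h <;> rw [h] <;> simp [h1]

section

variable {𝒳 : Finset (Finset ℕ)} {w : ℕ → ℕ} {D J X : Finset ℕ} {k : ℕ}

lemma BinaryWeights.subset {D' : Finset ℕ} (h : BinaryWeights w D k) (hD : D' ⊆ D) :
    BinaryWeights w D' k := by
  obtain ⟨l, h1, h2⟩ := h
  exact ⟨l, fun e he => h1 e (hD he), h2.mono (by exact_mod_cast hD)⟩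

lemma BinaryWeights.code_eq {l : ℕ → ℕ} (h1 : ∀ e ∈ D, w e = 2 ^ l e ∧ l e < k)
    (h2 : Set.InjOn l D) (X : Finset ℕ) : code w D X = ∑ j ∈ (X ∩ D).image l, 2 ^ j := by
  rw [code, Finset.sum_image]
  · exact Finset.sum_congr rfl fun e he => (h1 e (Finset.mem_inter.1 he).2).1
  · exact h2.mono (by simp)

lemma BinaryWeights.bit_iff (h : BinaryWeights w D k) {e : ℕ} (he : e ∈ D) (X : Finset ℕ) :
    code w D X % (w e + w e) < w e ↔ e ∉ X := by
  obtain ⟨l, h1, h2⟩ := h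
  rw [(h1 e he).1, ← not_iff_not, ← testBit_iff_le_mod, BinaryWeights.code_eq h1 h2,
    testBit_sum_two_pow, not_not]
  simp only [Finset.mem_image, Finset.mem_inter]
  constructor
  · rintro ⟨x, ⟨hx, hxD⟩, hl⟩
    rwa [← h2 hxD he hl]
  · exact fun hX => ⟨e, ⟨hX, he⟩, rfl⟩

lemma BinaryWeights.code_lt (h : BinaryWeights w D k) (X : Finset ℕ) :
    code w D X < 2 ^ k := by
  obtain ⟨l, h1, h2⟩ := h
  rw [BinaryWeights.code_eq h1 h2]
  refine Nat.geomSum_lt le_rfl ?_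
  simp only [Finset.mem_image, Finset.mem_inter]
  rintro _ ⟨x, ⟨_, hx⟩, rfl⟩
  exact (h1 x hx).2

lemma code_erase {e : ℕ} (he : e ∈ D) (X : Finset ℕ) :
    code w D X = code w (D.erase e) X + if e ∈ X then w e else 0 := by
  unfold code
  rw [Finset.inter_erase]
  split_ifs with h
  · rw [Finset.sum_erase_add _ _ (Finset.mem_inter.2 ⟨h, he⟩)]
  · rw [Finset.erase_eq_of_notMem (by simp [h])]; rfl

/-- Forgetting `e` in `D` has the same effect on the code as removing it from `X`, which clears its
bit. -/
lemma BinaryWeights.bit_erase (h : BinaryWeights w D k) {e : ℕ} (he : e ∈ D) (X : Finset ℕ) :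
    code w (D.erase e) X % (w e + w e) < w e := by
  have h1 := (h.bit_iff he (X.erase e)).2 (by simp)
  have h2 : code w D (X.erase e) = code w (D.erase e) X := by
    unfold code
    congr 1
    ext x; simp; tauto
  rwa [h2] at h1

lemma mod_add_half {x w : ℕ} (h : x % (w + w) < w) : ¬ (x + w) % (w + w) < w := by
  rw [Nat.add_mod, Nat.mod_eq_of_lt (show w < w + w by omega),
    Nat.mod_eq_of_lt (by omega)]
  omega

/-- Forgetting an element of `D` merges the entries that differ in its bit. -/
lemma BinaryWeights.table_erase (h : BinaryWeights w D k) {e : ℕ} (he : e ∈ D) (i : ℕ) :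
    table 𝒳 w (D.erase e) J i = if i % (w e + w e) < w e
      then table 𝒳 w D J i + table 𝒳 w D J (i + w e) else 0 := by
  unfold table
  split_ifs with hi
  · rw [← Finset.card_union_of_disjoint]
    · congr 1
      ext X
      simp only [Finset.mem_filter, Finset.mem_union]
      have h1 := h.bit_iff he X
      have h2 := code_erase (w := w) he X
      have h3 := mod_add_half hi
      by_cases hX : e ∈ X
      · rw [if_pos hX] at h2
        have : code w D X ≠ i := fun hh => (h1.1 (hh ▸ hi)) hX
        constructor
        · rintro ⟨a, b, c⟩; exact Or.inr ⟨a, b, by omega⟩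
        · rintro (⟨a, b, c⟩ | ⟨a, b, c⟩)
          · exact absurd c this
          · exact ⟨a, b, by omega⟩
      · rw [if_neg hX, add_zero] at h2
        have : code w D X ≠ i + w e := fun hh => h3 (hh ▸ h1.2 hX)
        rw [← h2]
        tauto
    · rw [Finset.disjoint_left]
      intro X h1 h2
      simp only [Finset.mem_filter] at h1 h2
      have h3 := mod_add_half hi
      rw [← h2.2.2, h1.2.2] at h3
      exact h3 hi
  · rw [Finset.card_eq_zero, Finset.filter_eq_empty_iff]
    rintro X - ⟨-, h2⟩
    exact hi (h2 ▸ h.bit_erase he X)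

/-- Requiring an element of `D` clears the entries in which its bit is not set. -/
lemma BinaryWeights.table_insert (h : BinaryWeights w D k) {e : ℕ} (he : e ∈ D) (i : ℕ) :
    table 𝒳 w D (insert e J) i = if i % (w e + w e) < w e then 0 else table 𝒳 w D J i := by
  unfold table
  split_ifs with hi
  · rw [Finset.card_eq_zero, Finset.filter_eq_empty_iff]
    rintro X - ⟨h1, h2⟩
    exact (h.bit_iff he X).1 (h2 ▸ hi) (h1 (Finset.mem_insert_self _ _))
  · congr 1
    refine Finset.filter_congr fun X _ => ?_
    have := h.bit_iff he X
    rw [Finset.insert_subset_iff]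
    constructor
    · rintro ⟨⟨_, a⟩, b⟩; exact ⟨a, b⟩
    · rintro ⟨a, b⟩; exact ⟨⟨not_not.1 fun hh => hi (b ▸ this.2 hh), a⟩, b⟩

lemma sum_table (h : BinaryWeights w D k) :
    ∑ i ∈ Finset.range (2 ^ k), table 𝒳 w D ∅ i = 𝒳.card := by
  rw [Finset.card_eq_sum_card_fiberwise (f := code w D) (t := Finset.range (2 ^ k))
    (fun X _ => by simpa using h.code_lt X)]
  simp [table]

/-- The table after a block whose incoming and outgoing arcs are `J` and `O`. -/
lemma table_step {O : Finset ℕ} {w' : ℕ → ℕ} (hJ : J ⊆ D) (hO : Disjoint O D)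
    (hOne : O.Nonempty)
    (hX : ∀ X ∈ 𝒳, Disjoint X O) (hw : ∀ e ∉ O, w' e = w e)
    (hsum : ∑ e ∈ O, w' e = ∑ e ∈ J, w e) (i : ℕ) :
    table (𝒳 ∪ (𝒳.filter fun X => J ⊆ X).image fun X => X \ J ∪ O) w' (D \ J ∪ O) ∅ i =
      table 𝒳 w (D \ J) ∅ i + table 𝒳 w D J i := by
  have hXO : ∀ {X : Finset ℕ} {e : ℕ}, X ∈ 𝒳 → e ∈ X → e ∉ O :=
    fun hX' he => Finset.disjoint_left.1 (hX _ hX') he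
  have hDO : ∀ {e : ℕ}, e ∈ D → e ∉ O := fun he => Finset.disjoint_right.1 hO he
  have c1 : ∀ X ∈ 𝒳, code w' (D \ J ∪ O) X = code w (D \ J) X := by
    intro X hX'
    unfold code
    have : X ∩ (D \ J ∪ O) = X ∩ (D \ J) := by
      ext e
      have := @hXO X e hX'
      simp only [Finset.mem_inter, Finset.mem_union, Finset.mem_sdiff]
      tauto
    rw [this]
    refine Finset.sum_congr rfl fun e he => hw e (hXO hX' (Finset.mem_inter.1 he).1)
  -- Exchanging `J` for `O` preserves the code because the two have the same total weight. The new
  -- table thus needs no re-indexing.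
  have c2 : ∀ X ∈ 𝒳, J ⊆ X → code w' (D \ J ∪ O) (X \ J ∪ O) = code w D X := by
    intro X hX' hJX
    unfold code
    have e1 : (X \ J ∪ O) ∩ (D \ J ∪ O) = (X ∩ D) \ J ∪ O := by
      ext e
      have := @hXO X e hX'
      have := @hDO e
      simp only [Finset.mem_inter, Finset.mem_union, Finset.mem_sdiff]
      tauto
    have e2 : J ⊆ X ∩ D := Finset.subset_inter hJX hJ
    rw [e1, Finset.sum_union, hsum, ← Finset.sum_sdiff e2]
    · congr 1
      refine Finset.sum_congr rfl fun e he => hw e ?_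
      simp only [Finset.mem_sdiff, Finset.mem_inter] at he
      exact hDO he.1.2
    · rw [Finset.disjoint_left]
      intro e he
      simp only [Finset.mem_sdiff, Finset.mem_inter] at he
      exact hDO he.1.2
  unfold table
  rw [Finset.filter_union, Finset.card_union_of_disjoint]
  · congr 1
    · congr 1
      refine Finset.filter_congr fun X hX' => ?_
      rw [c1 X hX']
    · rw [Finset.filter_image, Finset.card_image_of_injOn]
      · rw [Finset.filter_filter]
        congr 1
        refine Finset.filter_congr fun X hX' => ?_
        constructor
        · rintro ⟨a, -, b⟩; exact ⟨a, by rwa [c2 X hX' a] at b⟩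
        · rintro ⟨a, b⟩; exact ⟨a, by simp, by rwa [c2 X hX' a]⟩
      · intro X hX' Y hY' hXY
        simp only [Finset.coe_filter, Finset.mem_filter, Set.mem_ofPred_eq] at hX' hY' hXY
        ext e
        have h1 := @hXO X e hX'.1.1
        have h2 := @hXO Y e hY'.1.1
        have h3 := @hX'.1.2 e
        have h4 := @hY'.1.2 e
        have h5 := congrArg (e ∈ ·) hXY
        simp only [Finset.mem_union, Finset.mem_sdiff, eq_iff_iff] at h5
        tauto
  -- The new cuts contain `O` and the old ones avoid it; this is where `O` must be nonempty.
  · rw [Finset.disjoint_left]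
    intro Y h1 h2
    simp only [Finset.mem_filter, Finset.mem_image] at h1 h2
    obtain ⟨⟨X, -, rfl⟩, -⟩ := h2
    obtain ⟨e, he⟩ := hOne
    exact hXO h1.1 (Finset.mem_union_right _ he) he

end

/-! ## The network of an instance -/

namespace CutInstance

variable (I : CutInstance)

/-- The endpoint of an edge, read from the arrays of the input. -/
def endpt (f : Fin I.m → Fin I.n) (j : ℕ) : ℕ := if h : j < I.m then (f ⟨j, h⟩ : ℕ) else 0

/-- Edge `e` gives the arcs `e` and `e + m`. -/
def network : Network where
  n := I.n
  A := I.m + I.m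
  tl a := if a < I.m then I.endpt I.fst a else I.endpt I.snd (a - I.m)
  hd a := if a < I.m then I.endpt I.snd a else I.endpt I.fst (a - I.m)
  rev a := if a < I.m then a + I.m else a - I.m
  S := I.S.map Fin.valEmbedding
  T := I.T.map Fin.valEmbedding
  tl_lt a ha := by
    split_ifs with h
    · simp [endpt, h]
    · simp [endpt, show a - I.m < I.m by omega]
  rev_lt a ha := by split_ifs <;> omega
  rev_rev a ha := by split_ifs <;> omega
  rev_ne a ha := by split_ifs <;> omega
  tl_rev a ha := by
    split_ifs <;> first | omega | simp
  S_sub := by intro x; simp; rintro y _ rfl; exact y.2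
  disj := (Finset.disjoint_map _).2 I.disjoint

/-- The edges of a set of arcs. -/
def edges (Y : Finset ℕ) : Set (Fin I.m) := {e | (e : ℕ) ∈ Y ∨ (e : ℕ) + I.m ∈ Y}

variable {I} {r : ℕ → ℕ} {U W : Finset ℕ}

lemma mem_out_left (e : Fin I.m) :
    (e : ℕ) ∈ I.network.out W ↔ (I.fst e : ℕ) ∈ W ∧ (I.snd e : ℕ) ∉ W := by
  rw [Network.mem_out]
  have := e.2
  simp [network, endpt]
  omega

lemma mem_out_right (e : Fin I.m) :
    (e : ℕ) + I.m ∈ I.network.out W ↔ (I.snd e : ℕ) ∈ W ∧ (I.fst e : ℕ) ∉ W := by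
  rw [Network.mem_out]
  simp [network, endpt]

lemma mem_edges_out (e : Fin I.m) : e ∈ I.edges (I.network.out W) ↔
    ((I.fst e : ℕ) ∈ W ∧ (I.snd e : ℕ) ∉ W) ∨ ((I.snd e : ℕ) ∈ W ∧ (I.fst e : ℕ) ∉ W) := by
  rw [edges, Set.mem_ofPred_eq, mem_out_left, mem_out_right]

lemma isLink_out {e : Fin I.m} {x y : Fin I.n} (h : I.graph.IsLink e x y) (hx : (x : ℕ) ∈ W)
    (hy : (y : ℕ) ∉ W) : e ∈ I.edges (I.network.out W) := by
  rw [mem_edges_out]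
  rcases h with ⟨rfl, rfl⟩ | ⟨rfl, rfl⟩
  · exact Or.inl ⟨hx, hy⟩
  · exact Or.inr ⟨hx, hy⟩

lemma deleteEdges_adj {X : Set (Fin I.m)} {x y : Fin I.n} :
    (I.graph.deleteEdges X).Adj x y ↔ ∃ e ∉ X, I.graph.IsLink e x y := by
  simp only [Graph.Adj, Graph.deleteEdges_isLink]
  exact ⟨fun ⟨e, h⟩ => ⟨e, h.2, h.1⟩, fun ⟨e, h, h'⟩ => ⟨e, h', h⟩⟩

/-- A path that starts in `W` can leave it only through a deleted edge. -/
lemma isCut_edges_out (hW : I.network.Separates W) :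
    I.graph.IsCut I.S I.T (I.edges (I.network.out W)) := by
  refine ⟨fun e _ => Set.mem_univ e, fun s hs t ht hst => ?_⟩
  have hmem : ∀ y, (I.graph.deleteEdges (I.edges (I.network.out W))).Reaches s y →
      (y : ℕ) ∈ W := by
    intro y hy
    induction hy with
    | refl => exact hW.source (by simpa [network, Fin.val_inj] using hs)
    | tail _ h ih =>
      obtain ⟨e, he, hl⟩ := deleteEdges_adj.1 h
      by_contra hy
      exact he (isLink_out hl ih hy)
  exact Finset.disjoint_left.1 hW.target (hmem t hst) (by simpa [network, Fin.val_inj] using ht)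

/-- The witness is the set of vertices that remain reachable from `S` after `X` is deleted. -/
lemma exists_separates_of_isCut {X : Set (Fin I.m)} (hX : I.graph.IsCut I.S I.T X) :
    ∃ W ⊆ Finset.range I.n, I.network.Separates W ∧ I.edges (I.network.out W) ⊆ X := by
  classical
  let R : Finset (Fin I.n) :=
    Finset.univ.filter fun v => ∃ s ∈ I.S, (I.graph.deleteEdges X).Reaches s v
  have hR : ∀ v : Fin I.n, (v : ℕ) ∈ R.map Fin.valEmbedding ↔
      ∃ s ∈ I.S, (I.graph.deleteEdges X).Reaches s v := by
    intro v; simp [R, Fin.val_inj]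
  refine ⟨R.map Fin.valEmbedding, ?_, ⟨?_, ?_⟩, ?_⟩
  · intro x hx
    obtain ⟨v, -, rfl⟩ := Finset.mem_map.1 hx
    simp
  · intro x hx
    obtain ⟨v, hv, rfl⟩ := Finset.mem_map.1 hx
    exact (hR v).2 ⟨v, hv, Relation.ReflTransGen.refl⟩
  · rw [Finset.disjoint_right]
    intro x hx hx'
    obtain ⟨v, hv, rfl⟩ := Finset.mem_map.1 hx
    obtain ⟨s, hs, h⟩ := (hR v).1 hx'
    exact hX.2 s hs v hv h
  · intro e he
    by_contra heX
    rw [mem_edges_out, hR, hR] at he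
    rcases he with ⟨⟨s, hs, h⟩, h'⟩ | ⟨⟨s, hs, h⟩, h'⟩
    · exact h' ⟨s, hs, h.tail (deleteEdges_adj.2 ⟨e, heX, Or.inl ⟨rfl, rfl⟩⟩)⟩
    · exact h' ⟨s, hs, h.tail (deleteEdges_adj.2 ⟨e, heX, Or.inr ⟨rfl, rfl⟩⟩)⟩

lemma ncard_edges_out : (I.edges (I.network.out W)).ncard = (I.network.out W).card := by
  classical
  rw [← Set.ncard_image_of_injective _ Fin.val_injective]
  have : Fin.val '' I.edges (I.network.out W) =
      ((I.network.out W).image fun a => if a < I.m then a else a - I.m : Finset ℕ) := by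
    ext x
    simp only [Set.mem_image, edges, Set.mem_ofPred_eq, Finset.coe_image, Finset.mem_coe]
    constructor
    · rintro ⟨e, h | h, rfl⟩
      · exact ⟨_, h, by simp⟩
      · exact ⟨_, h, by simp⟩
    · rintro ⟨a, ha, rfl⟩
      have h1 : a < I.m + I.m := (Network.mem_out _).1 ha |>.1
      split_ifs with h
      · exact ⟨⟨a, h⟩, Or.inl ha, rfl⟩
      · refine ⟨⟨a - I.m, by omega⟩, Or.inr ?_, rfl⟩
        simpa [Nat.sub_add_cancel (not_lt.1 h)] using ha
  rw [this, Set.ncard_coe_finset, Finset.card_image_of_injOn]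
  intro a ha b hb hab
  rw [Finset.mem_coe, Network.mem_out] at ha hb
  have hA : I.network.A = I.m + I.m := rfl
  have ta := I.network.tl_rev a ha.1
  have tb := I.network.tl_rev b hb.1
  -- Two arcs of the same edge are opposite, and opposite arcs cannot both leave `W`.
  by_contra hne
  have hba : b = I.network.rev a := by
    simp only [network] at hab ⊢
    split_ifs at hab ⊢ <;> omega
  rw [hba, ta, I.network.hd_rev ha.1] at hb
  exact hb.2.2 ha.2.1

lemma exists_isCut_ncard (I : CutInstance) :
    ∃ X, I.graph.IsCut I.S I.T X ∧ X.ncard = I.minCutSize := by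
  refine Nat.sInf_mem (s := {k | ∃ X : Set (Fin I.m), I.graph.IsCut I.S I.T X ∧ X.ncard = k})
    ⟨_, _, isCut_edges_out (W := I.network.S) ⟨subset_rfl, I.network.disj⟩, rfl⟩

lemma minCutSize_le {X : Set (Fin I.m)} (hX : I.graph.IsCut I.S I.T X) :
    I.minCutSize ≤ X.ncard :=
  Nat.sInf_le ⟨X, hX, rfl⟩

lemma val_le_ncard (hr : I.network.IsFlow r) {X : Set (Fin I.m)}
    (hX : I.graph.IsCut I.S I.T X) : I.network.val r ≤ X.ncard := by
  obtain ⟨W, -, hW, hWX⟩ := exists_separates_of_isCut hX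
  refine (hr.val_le hW).trans ?_
  rw [← ncard_edges_out]
  exact_mod_cast Set.ncard_le_ncard hWX

lemma val_le_minCutSize (hr : I.network.IsFlow r) : I.network.val r ≤ I.minCutSize := by
  obtain ⟨X, hX, h⟩ := I.exists_isCut_ncard
  exact h ▸ val_le_ncard hr hX

/-- Duality: every flow value is at most every cut size, and a closed separating set attains
equality. -/
lemma minCutSize_eq (hr : I.network.IsFlow r) (hU : I.network.Separates U)
    (hc : I.network.Closed r U) : (I.minCutSize : ℤ) = I.network.val r := by
  refine le_antisymm ?_ (val_le_minCutSize hr)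
  rw [← (hr.closed_iff_card hU).1 hc, ← ncard_edges_out]
  exact_mod_cast minCutSize_le (isCut_edges_out hU)

lemma card_out_eq (hr : I.network.IsFlow r) (hU : I.network.Separates U)
    (hc : I.network.Closed r U) : (I.network.out U).card = I.minCutSize := by
  have h1 := minCutSize_eq hr hU hc
  have h2 := (hr.closed_iff_card hU).1 hc
  omega

lemma isMinCut_iff (hr : I.network.IsFlow r) (hU : I.network.Separates U)
    (hc : I.network.Closed r U) (X : Set (Fin I.m)) :
    I.graph.IsMinCut I.S I.T X ↔ ∃ W ⊆ Finset.range I.n, I.network.Separates W ∧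
      I.network.Closed r W ∧ I.edges (I.network.out W) = X := by
  have hen : ∀ Y : Set (Fin I.m), Y.encard = Y.ncard := fun Y =>
    (Set.Finite.cast_ncard_eq Y.toFinite).symm
  constructor
  · rintro ⟨hX, hmin⟩
    obtain ⟨W, hWn, hW, hWX⟩ := exists_separates_of_isCut hX
    have h1 := hmin _ (isCut_edges_out hU)
    rw [hen, hen, ncard_edges_out, card_out_eq hr hU hc] at h1
    have h2 : X.ncard ≤ I.minCutSize := by exact_mod_cast h1
    have h3 := minCutSize_le (isCut_edges_out hW)
    -- The cut around `W` lies inside the minimum cut `X` and cannot be smaller, so it is all of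
    -- `X`.
    have h4 : I.edges (I.network.out W) = X := Set.eq_of_subset_of_ncard_le hWX (h2.trans h3)
    refine ⟨W, hWn, hW, (hr.closed_iff_card hW).2 ?_, h4⟩
    rw [← minCutSize_eq hr hU hc, ← ncard_edges_out, h4]
    rw [h4] at h3
    exact_mod_cast le_antisymm h2 h3
  · rintro ⟨W, -, hW, hWc, rfl⟩
    refine ⟨isCut_edges_out hW, fun Y hY => ?_⟩
    rw [hen, hen, ncard_edges_out, card_out_eq hr hW hWc]
    exact_mod_cast minCutSize_le hY

/-- The minimum cuts are counted by the arc sets that leave the closed sets of vertices. -/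
lemma numMinCuts_eq (hr : I.network.IsFlow r) (hU : I.network.Separates U)
    (hUn : U ⊆ Finset.range I.n) (hc : I.network.Closed r U)
    (hmax : ∀ W ⊆ Finset.range I.n, I.network.Separates W → I.network.Closed r W → W ⊆ U) :
    I.numMinCuts = (I.network.cuts r U).card := by
  have : {X : Set (Fin I.m) | I.graph.IsMinCut I.S I.T X} =
      I.edges '' (I.network.cuts r U : Set (Finset ℕ)) := by
    ext X
    rw [Set.mem_ofPred_eq, isMinCut_iff hr hU hc]
    simp only [Set.mem_image, Finset.mem_coe, Network.mem_cuts]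
    constructor
    · rintro ⟨W, hWn, hW, hWc, rfl⟩
      exact ⟨_, ⟨W, hmax W hWn hW hWc, hW.source, hWc, rfl⟩, rfl⟩
    · rintro ⟨_, ⟨W, hWU, hSW, hWc, rfl⟩, rfl⟩
      exact ⟨W, hWU.trans hUn, ⟨hSW, hU.target.mono_left hWU⟩, hWc, rfl⟩
  rw [numMinCuts, this, Set.InjOn.ncard_image, Set.ncard_coe_finset]
  -- Passing from arcs to edges loses no information: an arc of a cut has `r a = 0`, so its opposite
  -- has capacity `2` and lies in no cut. The orientation of each cut edge is dictated by the flow.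
  have key : ∀ X ∈ I.network.cuts r U, ∀ Y ∈ I.network.cuts r U,
      I.edges X = I.edges Y → X ⊆ Y := by
    intro X hX Y hY hXY a ha
    obtain ⟨V, -, -, hV, rfl⟩ := Network.mem_cuts.1 hX
    obtain ⟨W, -, -, hW, rfl⟩ := Network.mem_cuts.1 hY
    have haA : a < I.m + I.m := ((Network.mem_out _).1 ha).1
    have h0 : r a = 0 := Network.closed_iff.1 hV a ha
    have h1 : I.network.rev a ∉ I.network.out W := fun h =>
      Network.rev_residual hr.balanced (a := a) haA h0 (Network.closed_iff.1 hW _ h)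
    by_cases hm : a < I.m
    · have h2 : (⟨a, hm⟩ : Fin I.m) ∈ I.edges (I.network.out V) := Or.inl ha
      rw [hXY] at h2
      refine h2.resolve_right fun h => h1 ?_
      simpa [network, hm] using h
    · have h2 : (⟨a - I.m, by omega⟩ : Fin I.m) ∈ I.edges (I.network.out V) :=
        Or.inr (by simpa [Nat.sub_add_cancel (not_lt.1 hm)] using ha)
      rw [hXY] at h2
      have h3 := h2.resolve_left fun h => h1 (by simpa [network, hm] using h)
      simpa [Nat.sub_add_cancel (not_lt.1 hm)] using h3
  intro X hX Y hY hXY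
  exact (key X hX Y hY hXY).antisymm (key Y hY X hX hXY.symm)

end CutInstance

/-! ## Verification of programs -/

namespace RAM

infixr:60 " ;; " => Prog.seq

/-- Whether a program assigns to a register. -/
def Prog.setsReg : Prog → ℕ → Bool
  | .skip, _ => false
  | .set i _, j => decide (j = i)
  | .store _ _ _, _ => false
  | .seq P Q, j => P.setsReg j || Q.setsReg j
  | .ite _ P Q, j => P.setsReg j || Q.setsReg j
  | .loop _ P, j => P.setsReg j

/-- Whether a program assigns to an array. -/
def Prog.setsArr : Prog → ℕ → Bool
  | .skip, _ => false
  | .set _ _, _ => false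
  | .store a _ _, b => decide (b = a)
  | .seq P Q, j => P.setsArr j || Q.setsArr j
  | .ite _ P Q, j => P.setsArr j || Q.setsArr j
  | .loop _ P, j => P.setsArr j

/-- The registers and arrays that `P` does not assign to agree in `σ` and `τ`. -/
structure Frame (P : Prog) (σ τ : State) : Prop where
  reg : ∀ j, P.setsReg j = false → τ.reg j = σ.reg j
  arr : ∀ a, P.setsArr a = false → τ.arr a = σ.arr a

@[simp] lemma State.setReg_reg (σ : State) (i v j : ℕ) :
    (σ.setReg i v).reg j = if j = i then v else σ.reg j := by
  simp [State.setReg, Function.update_apply]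

@[simp] lemma State.setReg_arr (σ : State) (i v : ℕ) : (σ.setReg i v).arr = σ.arr := rfl

@[simp] lemma State.setArr_reg (σ : State) (a j v : ℕ) : (σ.setArr a j v).reg = σ.reg := rfl

@[simp] lemma State.setArr_arr (σ : State) (a j v b : ℕ) :
    (σ.setArr a j v).arr b = if b = a then Function.update (σ.arr a) j v else σ.arr b := by
  simp [State.setArr, Function.update_apply]

/-- Reduces each later claim that a register or array is untouched to a computation on the program
text, closed by `rfl`. -/
lemma Exec.frame {P : Prog} {σ τ : State} {t : ℕ} (h : Exec P σ t τ) : Frame P σ τ := by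
  induction h with
  | skip => exact ⟨fun _ _ => rfl, fun _ _ => rfl⟩
  | set => exact ⟨fun j hj => by simp_all [Prog.setsReg], fun _ _ => rfl⟩
  | store => exact ⟨fun _ _ => rfl, fun b hb => by simp_all [Prog.setsArr]⟩
  | seq _ _ h1 h2 =>
    constructor
    · intro j hj
      simp only [Prog.setsReg, Bool.or_eq_false_iff] at hj
      rw [h2.reg j hj.2, h1.reg j hj.1]
    · intro j hj
      simp only [Prog.setsArr, Bool.or_eq_false_iff] at hj
      rw [h2.arr j hj.2, h1.arr j hj.1]
  | ite_true _ _ h1 =>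
    constructor
    · intro j hj
      simp only [Prog.setsReg, Bool.or_eq_false_iff] at hj
      exact h1.reg j hj.1
    · intro j hj
      simp only [Prog.setsArr, Bool.or_eq_false_iff] at hj
      exact h1.arr j hj.1
  | ite_false _ _ h1 =>
    constructor
    · intro j hj
      simp only [Prog.setsReg, Bool.or_eq_false_iff] at hj
      exact h1.reg j hj.2
    · intro j hj
      simp only [Prog.setsArr, Bool.or_eq_false_iff] at hj
      exact h1.arr j hj.2
  | loop_done => exact ⟨fun _ _ => rfl, fun _ _ => rfl⟩
  | loop_step _ _ _ h1 h2 =>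
    exact ⟨fun j hj => by rw [h2.reg j hj, h1.reg j hj],
      fun j hj => by rw [h2.arr j hj, h1.arr j hj]⟩

/-- `P`, started in `σ`, halts after at most `b` steps in a state that satisfies `Q`. -/
def Runs (P : Prog) (σ : State) (b : ℕ) (Q : State → Prop) : Prop :=
  ∃ t τ, Exec P σ t τ ∧ t ≤ b ∧ Q τ

/-- The effect of a program without loops. -/
def Prog.run : Prog → State → State
  | .skip, σ => σ
  | .set i e, σ => σ.setReg i (e.eval σ)
  | .store a j e, σ => σ.setArr a (j.eval σ) (e.eval σ)
  | .seq P Q, σ => Q.run (P.run σ)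
  | .ite e P Q, σ => if e.eval σ ≠ 0 then P.run σ else Q.run σ
  | .loop _ _, σ => σ

/-- A bound for the number of steps of a program without loops. -/
def Prog.time : Prog → ℕ
  | .skip => 1
  | .set _ e => e.cost + 1
  | .store _ j e => j.cost + e.cost + 1
  | .seq P Q => P.time + Q.time
  | .ite e P Q => e.cost + 1 + max P.time Q.time
  | .loop _ _ => 0

/-- Whether a program has no loops. -/
def Prog.loopFree : Prog → Bool
  | .seq P Q => P.loopFree && Q.loopFree
  | .ite _ P Q => P.loopFree && Q.loopFree
  | .loop _ _ => false
  | _ => true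

/-- Loop-free bodies can thus be verified by evaluating `run`; their time bound takes the slower
branch of each test. -/
lemma exec_run {P : Prog} (hP : P.loopFree = true) (σ : State) :
    ∃ t ≤ P.time, Exec P σ t (P.run σ) := by
  induction P generalizing σ with
  | skip => exact ⟨1, le_rfl, .skip σ⟩
  | set i e => exact ⟨_, le_rfl, .set σ i e⟩
  | store a j e => exact ⟨_, le_rfl, .store σ a j e⟩
  | seq P Q hp hq =>
    simp only [Prog.loopFree, Bool.and_eq_true] at hP
    obtain ⟨t, ht, h1⟩ := hp hP.1 σ
    obtain ⟨u, hu, h2⟩ := hq hP.2 (P.run σ)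
    exact ⟨t + u, Nat.add_le_add ht hu, .seq h1 h2⟩
  | ite e P Q hp hq =>
    simp only [Prog.loopFree, Bool.and_eq_true] at hP
    by_cases he : e.eval σ = 0
    · obtain ⟨t, ht, h1⟩ := hq hP.2 σ
      refine ⟨e.cost + 1 + t, ?_, ?_⟩
      · simp only [Prog.time]; have := le_max_right P.time Q.time; omega
      · simpa [Prog.run, he] using Exec.ite_false he h1
    · obtain ⟨t, ht, h1⟩ := hp hP.1 σ
      refine ⟨e.cost + 1 + t, ?_, ?_⟩
      · simp only [Prog.time]; have := le_max_left P.time Q.time; omega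
      · simpa [Prog.run, he] using Exec.ite_true he h1
  | loop e P => simp [Prog.loopFree] at hP

namespace Runs

variable {P R : Prog} {σ : State} {b b₁ b₂ c : ℕ} {Q Q' : State → Prop}

lemma of_run (hP : P.loopFree = true) (hb : P.time ≤ b) (hQ : Q (P.run σ)) : Runs P σ b Q := by
  obtain ⟨t, ht, h⟩ := exec_run hP σ
  exact ⟨t, _, h, ht.trans hb, hQ⟩

lemma mono (h : Runs P σ b₁ Q) (hb : b₁ ≤ b) (hQ : ∀ τ, Frame P σ τ → Q τ → Q' τ) :
    Runs P σ b Q' := by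
  obtain ⟨t, τ, h1, h2, h3⟩ := h
  exact ⟨t, τ, h1, h2.trans hb, hQ τ h1.frame h3⟩

lemma seq (b₁ b₂ : ℕ) (h : Runs P σ b₁ Q') (hR : ∀ τ, Frame P σ τ → Q' τ → Runs R τ b₂ Q)
    (hb : b₁ + b₂ ≤ b) : Runs (P ;; R) σ b Q := by
  obtain ⟨t, τ, h1, h2, h3⟩ := h
  obtain ⟨u, ρ, h4, h5, h6⟩ := hR τ h1.frame h3
  exact ⟨t + u, ρ, .seq h1 h4, by omega, h6⟩

lemma run_seq (b₂ : ℕ) (hP : P.loopFree = true) (hR : Runs R (P.run σ) b₂ Q)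
    (hb : P.time + b₂ ≤ b) : Runs (P ;; R) σ b Q :=
  seq P.time b₂ (Q' := fun τ => τ = P.run σ) (of_run hP le_rfl rfl) (fun _ _ h => h ▸ hR) hb

lemma ite {e : Expr} (b₂ : ℕ) (h1 : e.eval σ ≠ 0 → Runs P σ b₂ Q)
    (h2 : e.eval σ = 0 → Runs R σ b₂ Q) (hb : e.cost + 1 + b₂ ≤ b) :
    Runs (.ite e P R) σ b Q := by
  by_cases he : e.eval σ = 0
  · obtain ⟨t, τ, h3, h4, h5⟩ := h2 he
    exact ⟨_, τ, .ite_false he h3, by omega, h5⟩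
  · obtain ⟨t, τ, h3, h4, h5⟩ := h1 he
    exact ⟨_, τ, .ite_true he h3, by omega, h5⟩

/-- A loop whose variant `μ` decreases. -/
lemma loop {e : Expr} (Inv : ℕ → State → Prop) (μ : ℕ) (h0 : Inv μ σ)
    (hstep : ∀ k τ, Inv k τ → e.eval τ ≠ 0 → Runs P τ c fun τ' => ∃ k' < k, Inv k' τ')
    (hend : ∀ k τ, Inv k τ → e.eval τ = 0 → Q τ)
    (hb : (μ + 1) * (c + e.cost + 1) ≤ b) : Runs (.loop e P) σ b Q := by
  suffices h : ∀ k σ, Inv k σ → Runs (.loop e P) σ ((k + 1) * (c + e.cost + 1)) Q from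
    (h μ σ h0).mono hb fun _ _ h => h
  intro k
  induction k using Nat.strong_induction_on with
  | _ k ih =>
    intro σ hσ
    by_cases he : e.eval σ = 0
    · exact ⟨_, σ, .loop_done he, by nlinarith, hend k σ hσ he⟩
    · obtain ⟨t, τ, h1, h2, k', hk', h3⟩ := hstep k σ hσ he
      obtain ⟨u, ρ, h4, h5, h6⟩ := ih k' hk' τ h3
      refine ⟨_, ρ, .loop_step he h1 h4, ?_, h6⟩
      have h7 : (k' + 1) * (c + e.cost + 1) ≤ k * (c + e.cost + 1) :=
        Nat.mul_le_mul_right _ hk'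
      have h8 : (k + 1) * (c + e.cost + 1) = k * (c + e.cost + 1) + (c + e.cost + 1) := by ring
      omega

end Runs

/-- `P` is repeated with register `i` running from `0` to the content of register `b`. -/
def Prog.forLoop (i b : ℕ) (P : Prog) : Prog :=
  .set i (.const 0) ;;
    .loop (.sub (.reg b) (.reg i)) (P ;; .set i (.add (.reg i) (.const 1)))

namespace Runs

variable {P : Prog} {σ : State} {B c : ℕ} {Q : State → Prop}

/-- The invariant is required after the increment of `i`. In the bound, `2` pays for the initial
assignment, and each round adds `4` for the increment and `4` for the test to the cost `c` of the
body. -/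
lemma forLoop {i b N : ℕ} (Inv : ℕ → State → Prop) (hi : P.setsReg i = false)
    (hb : P.setsReg b = false) (hbi : b ≠ i) (hN : σ.reg b = N) (h0 : Inv 0 (σ.setReg i 0))
    (hstep : ∀ k < N, ∀ τ, Frame (.forLoop i b P) σ τ → τ.reg i = k → Inv k τ →
      Runs P τ c fun τ' => Inv (k + 1) (τ'.setReg i (k + 1)))
    (hend : ∀ τ, Frame (.forLoop i b P) σ τ → Inv N τ → Q τ)
    (hB : 2 + (N + 1) * (c + 8) ≤ B) : Runs (.forLoop i b P) σ B Q := by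
  have hF : ∀ j, (Prog.forLoop i b P).setsReg j = false → j ≠ i ∧ P.setsReg j = false := by
    intro j hj
    simp only [Prog.forLoop, Prog.setsReg, Bool.or_eq_false_iff, decide_eq_false_iff_not] at hj
    exact ⟨hj.1, hj.2.1⟩
  have hA : ∀ j, (Prog.forLoop i b P).setsArr j = P.setsArr j := by
    simp [Prog.forLoop, Prog.setsArr]
  have hbF : (Prog.forLoop i b P).setsReg b = false := by
    simp [Prog.forLoop, Prog.setsReg, hb, hbi]
  refine run_seq ((N + 1) * (c + 4 + 3 + 1)) rfl ?_ hB
  refine loop (c := c + 4) (fun μ τ => ∃ k ≤ N, μ = N - k ∧ τ.reg i = k ∧ Inv k τ ∧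
    Frame (.forLoop i b P) σ τ) N ?_ ?_ ?_ le_rfl
  · refine ⟨0, Nat.zero_le _, rfl, by simp [Prog.run, Expr.eval], h0, ?_, fun _ _ => rfl⟩
    intro j hj
    simp [Prog.run, (hF j hj).1]
  · rintro _ τ ⟨k, hk, rfl, hki, hInv, hFr⟩ he
    have hkN : k < N := by
      simp only [Expr.eval, hki, hFr.reg b hbF, hN] at he
      omega
    refine seq c 4 (hstep k hkN τ hFr hki hInv) (fun τ' hF' h => ?_) le_rfl
    have hi' : τ'.reg i = k := by rw [hF'.reg i hi, hki]
    refine of_run rfl le_rfl ⟨N - (k + 1), by omega, k + 1, hkN, rfl, ?_, ?_, ?_, ?_⟩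
    · simp [Prog.run, Expr.eval, hi']
    · simpa [Prog.run, Expr.eval, hi'] using h
    · intro j hj
      simp [Prog.run, (hF j hj).1, hF'.reg j (hF j hj).2, hFr.reg j hj]
    · intro a ha
      simp [Prog.run, hF'.arr a (hA a ▸ ha), hFr.arr a ha]
  · rintro _ τ ⟨k, hk, rfl, hki, hInv, hFr⟩ he
    have hkN : k = N := by
      simp only [Expr.eval, hki, hFr.reg b hbF, hN] at he
      omega
    exact hend τ hFr (hkN ▸ hInv)

end Runs

end RAM

/-! ## The program -/

namespace CountCuts

open RAM

/-- Array `5` receives the characteristic function of the sources. -/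
def initMark : Prog := .forLoop 6 0 (.store 5 (.reg 6) (.load 2 (.reg 6)))

/-- If the arc in register `3` is residual and leads from a marked vertex to an unmarked one, then
the latter is marked with the clock, and the arc is recorded as its parent. -/
def scanArc : Prog :=
  .ite (.load 5 (.load 0 (.reg 3)))
    (.ite (.load 5 (.load 1 (.reg 3))) .skip
      (.ite (.load 4 (.reg 3))
        (.store 5 (.load 1 (.reg 3)) (.reg 5) ;;
          .store 6 (.load 1 (.reg 3)) (.reg 3) ;;
          .set 5 (.add (.reg 5) (.const 1)))
        .skip))
    .skip

/-- All vertices that are reachable by residual arcs from marked vertices are marked. -/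
def search : Prog := .set 5 (.const 2) ;; .forLoop 4 0 (.forLoop 3 2 scanArc)

/-- Arrays for the arcs: tails, heads, opposites, residual capacities. -/
def makeArcs : Prog :=
  .set 2 (.add (.reg 1) (.reg 1)) ;;
  .forLoop 3 1
    (.store 0 (.add (.reg 3) (.reg 1)) (.load 1 (.reg 3)) ;;
      .store 1 (.add (.reg 3) (.reg 1)) (.load 0 (.reg 3)) ;;
      .store 12 (.reg 3) (.add (.reg 3) (.reg 1)) ;;
      .store 12 (.add (.reg 3) (.reg 1)) (.reg 3) ;;
      .store 4 (.reg 3) (.const 1) ;;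
      .store 4 (.add (.reg 3) (.reg 1)) (.const 1))

/-- Register `7` receives `t + 1` for a marked target `t`, or `0` if there is none. -/
def findTarget : Prog :=
  .set 7 (.const 0) ;;
  .forLoop 6 0
    (.ite (.load 3 (.reg 6)) (.ite (.load 5 (.reg 6)) (.set 7 (.add (.reg 6) (.const 1))) .skip)
      .skip)

/-- One unit is sent along the parent of the vertex in register `7`, which is replaced by the tail
of this arc. -/
def stepBack : Prog :=
  .set 3 (.load 6 (.reg 7)) ;;
  .store 4 (.reg 3) (.sub (.load 4 (.reg 3)) (.const 1)) ;;
  .store 4 (.load 12 (.reg 3)) (.add (.load 4 (.load 12 (.reg 3))) (.const 1)) ;;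
  .set 7 (.load 0 (.reg 3))

/-- One unit is sent along the path of parents to the vertex in register `7`. -/
def augment : Prog := .loop (.sub (.load 5 (.reg 7)) (.const 1)) stepBack

/-- A flow is augmented as long as a target is reachable from the sources. -/
def maxFlow : Prog :=
  .set 8 (.const 1) ;;
  .loop (.reg 8)
    (initMark ;; search ;; findTarget ;;
      .ite (.reg 7) (.set 7 (.sub (.reg 7) (.const 1)) ;; augment) (.set 8 (.const 0)))

/-- The marked vertices are added to array `7`. -/
def absorb : Prog :=
  .forLoop 6 0 (.ite (.load 5 (.reg 6)) (.store 7 (.reg 6) (.const 1)) .skip)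

/-- The arcs that leave the set of array `7` receive the weights `1, 2, 4, …` in array `8`;
register `9` receives the next power of two; the table in array `9` is initialized. -/
def initTable : Prog :=
  .set 9 (.const 1) ;;
  .forLoop 3 2
    (.ite (.load 7 (.load 0 (.reg 3)))
      (.ite (.load 7 (.load 1 (.reg 3))) .skip
        (.store 8 (.reg 3) (.reg 9) ;; .set 9 (.add (.reg 9) (.reg 9))))
      .skip) ;;
  .store 9 (.sub (.reg 9) (.const 1)) (.const 1)

/-- Register `12` receives the number of marked vertices, register `13` tells whether one of them is
a target. -/
def countMarked : Prog :=
  .set 12 (.const 0) ;; .set 13 (.const 0) ;;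
  .forLoop 6 0
    (.ite (.load 5 (.reg 6))
      (.set 12 (.add (.reg 12) (.const 1)) ;;
        .ite (.load 3 (.reg 6)) (.set 13 (.const 1)) .skip)
      .skip)

/-- Array `9` is copied to array `10`. -/
def copyTable : Prog := .forLoop 16 9 (.store 10 (.reg 16) (.load 9 (.reg 16)))

/-- The bit of weight `w`, in register `18`, is projected out of the table in array `9` and required
in the table in array `10`. Register `17` holds the current index modulo `2 * w`. -/
def splitTable : Prog :=
  .set 17 (.const 0) ;;
  .forLoop 16 9
    (.ite (.sub (.reg 18) (.reg 17))
        (.store 9 (.reg 16)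
            (.add (.load 9 (.reg 16)) (.load 9 (.add (.reg 16) (.reg 18)))) ;;
          .store 10 (.reg 16) (.const 0))
        (.store 9 (.reg 16) (.const 0)) ;;
      .set 17 (.add (.reg 17) (.const 1)) ;;
      .ite (.sub (.add (.reg 18) (.reg 18)) (.reg 17)) .skip (.set 17 (.const 0)))

/-- The arcs from the set of array `7` to newly marked vertices are processed and collected in
array `11`. -/
def enterBlock : Prog :=
  .set 14 (.const 0) ;;
  .forLoop 3 2
    (.ite (.load 7 (.load 0 (.reg 3)))
      (.ite (.load 7 (.load 1 (.reg 3))) .skip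
        (.ite (.load 5 (.load 1 (.reg 3)))
          (.store 11 (.reg 14) (.reg 3) ;; .set 14 (.add (.reg 14) (.const 1)) ;;
            .set 18 (.load 8 (.reg 3)) ;; splitTable)
          .skip))
      .skip)

/-- The arcs that leave the newly marked vertices inherit the weights of those that enter them. -/
def leaveBlock : Prog :=
  .set 15 (.const 0) ;;
  .forLoop 3 2
    (.ite (.load 5 (.load 0 (.reg 3)))
      (.ite (.add (.load 7 (.load 0 (.reg 3)))
          (.add (.load 7 (.load 1 (.reg 3))) (.load 5 (.load 1 (.reg 3))))) .skip
        (.store 8 (.reg 3) (.load 8 (.load 11 (.reg 15))) ;;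
          .set 15 (.add (.reg 15) (.const 1))))
      .skip)

/-- The two tables are added in array `9` unless register `14` is zero. -/
def mergeTables : Prog :=
  .ite (.reg 14)
    (.forLoop 16 9 (.store 9 (.reg 16) (.add (.load 9 (.reg 16)) (.load 10 (.reg 16))))) .skip

/-- The newly marked vertices are added as one block. -/
def addBlock : Prog := copyTable ;; enterBlock ;; leaveBlock ;; mergeTables ;; absorb

/-- The vertices reachable from the vertex in register `11` and the sources are added as a block, if
there is no target among them and their number is the content of register `10`. -/
def tryVertex : Prog :=
  .ite (.load 7 (.reg 11)) .skip
    (initMark ;; .store 5 (.reg 11) (.const 1) ;; search ;; countMarked ;;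
      .ite (.add (.reg 13) (.add (.sub (.reg 12) (.reg 10)) (.sub (.reg 10) (.reg 12)))) .skip
        addBlock)

/-- The blocks are added in the order of the numbers of vertices reachable from them. -/
def addBlocks : Prog :=
  .set 20 (.add (.reg 0) (.const 1)) ;; .forLoop 10 20 (.forLoop 11 0 tryVertex)

/-- Register `0` receives the sum of the table. -/
def sumTable : Prog :=
  .set 19 (.const 0) ;; .forLoop 16 9 (.set 19 (.add (.reg 19) (.load 9 (.reg 16)))) ;;
  .set 0 (.reg 19)

/-- The number of minimum cuts is computed. -/
def main : Prog := makeArcs ;; maxFlow ;; absorb ;; initTable ;; addBlocks ;; sumTable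

/-! ## Search -/

/-- Registers and arrays hold the network `N`. -/
structure Stores (N : Network) (σ : State) : Prop where
  n : σ.reg 0 = N.n
  A : σ.reg 2 = N.A
  tl : ∀ a < N.A, σ.arr 0 a = N.tl a
  hd : ∀ a < N.A, σ.arr 1 a = N.hd a
  rev : ∀ a < N.A, σ.arr 12 a = N.rev a
  S : ∀ v < N.n, σ.arr 2 v = if v ∈ N.S then 1 else 0
  T : ∀ v < N.n, σ.arr 3 v ≠ 0 ↔ v ∈ N.T

/-- Whether a program leaves the data of the network unchanged. -/
def keepsInput (P : Prog) : Bool :=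
  !P.setsReg 0 && !P.setsReg 2 && !P.setsArr 0 && !P.setsArr 1 && !P.setsArr 12 &&
    !P.setsArr 2 && !P.setsArr 3

lemma Stores.frame {N : Network} {P : Prog} {σ τ : State} (h : Stores N σ) (hF : Frame P σ τ)
    (hP : keepsInput P = true) : Stores N τ := by
  simp only [keepsInput, Bool.and_eq_true, Bool.not_eq_true'] at hP
  obtain ⟨⟨⟨⟨⟨⟨h0, h2⟩, a0⟩, a1⟩, a12⟩, a2⟩, a3⟩ := hP
  constructor
  · rw [hF.reg _ h0, h.n]
  · rw [hF.reg _ h2, h.A]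
  · rw [hF.arr _ a0]; exact h.tl
  · rw [hF.arr _ a1]; exact h.hd
  · rw [hF.arr _ a12]; exact h.rev
  · rw [hF.arr _ a2]; exact h.S
  · rw [hF.arr _ a3]; exact h.T

/-- The vertices with a nonzero entry. -/
def support (n : ℕ) (f : ℕ → ℕ) : Finset ℕ := (Finset.range n).filter fun v => f v ≠ 0

lemma mem_support {n v : ℕ} {f : ℕ → ℕ} : v ∈ support n f ↔ v < n ∧ f v ≠ 0 := by
  simp [support]

lemma card_support_le (n : ℕ) (f : ℕ → ℕ) : (support n f).card ≤ n :=
  (Finset.card_filter_le _ _).trans (Finset.card_range n).le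

lemma card_support_update {n v x : ℕ} {f : ℕ → ℕ} (hv : v < n) (h : f v = 0) (hx : x ≠ 0) :
    (support n (Function.update f v x)).card = (support n f).card + 1 := by
  have : support n (Function.update f v x) = insert v (support n f) := by
    ext u
    simp only [mem_support, Finset.mem_insert, Function.update_apply]
    split_ifs with hu
    · simp [hu, hv, hx]
    · simp [hu]
  rw [this, Finset.card_insert_of_notMem (by simp [mem_support, h])]

/-- The state of a search that starts at the vertices of `M`. -/
structure Marked (N : Network) (r : ℕ → ℕ) (M : Finset ℕ) (mark par : ℕ → ℕ) (clock : ℕ) :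
    Prop where
  clock_two : 2 ≤ clock
  clock_le : clock ≤ (support N.n mark).card + 2
  start : ∀ v < N.n, mark v = 1 ↔ v ∈ M
  lt_clock : ∀ v < N.n, mark v < clock
  sound : ∀ C, N.Closed r C → M ⊆ C → support N.n mark ⊆ C
  parent : ∀ v < N.n, 1 < mark v → par v < N.A ∧ N.hd (par v) = v ∧ r (par v) ≠ 0 ∧
    mark (N.tl (par v)) ≠ 0 ∧ mark (N.tl (par v)) < mark v

variable {N : Network} {r : ℕ → ℕ} {M : Finset ℕ}

/-- The clock exceeds all earlier marks, so a parent arc always starts at a vertex with a smaller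
mark, and following parents must end at a vertex of mark `1`, which belongs to `M`. -/
lemma Marked.mark {mark par : ℕ → ℕ} {clock a : ℕ} (h : Marked N r M mark par clock)
    (ha : a < N.A) (h1 : mark (N.tl a) ≠ 0) (h2 : mark (N.hd a) = 0) (h3 : r a ≠ 0) :
    Marked N r M (Function.update mark (N.hd a) clock) (Function.update par (N.hd a) a)
      (clock + 1) := by
  have hc := h.clock_two
  have hh := N.hd_lt ha
  have ht := N.tl_lt a ha
  have hne : N.tl a ≠ N.hd a := fun e => h1 (e ▸ h2)
  constructor
  · omega
  · rw [card_support_update hh h2 (by omega)]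
    have := h.clock_le
    omega
  · intro v hv
    rw [Function.update_apply]
    split_ifs with hva
    · have := (h.start v hv)
      rw [hva, h2] at this
      rw [hva, ← this]
      omega
    · exact h.start v hv
  · intro v hv
    rw [Function.update_apply]
    have := h.lt_clock v hv
    split_ifs <;> omega
  · intro C hC hM v hv
    rw [mem_support, Function.update_apply] at hv
    split_ifs at hv with hva
    · rw [hva]
      exact hC a ha h3 (h.sound C hC hM (mem_support.2 ⟨ht, h1⟩))
    · exact h.sound C hC hM (mem_support.2 hv)
  · intro v hv hv1
    rw [Function.update_apply] at hv1
    by_cases hva : v = N.hd a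
    · subst hva
      simp only [Function.update_self, Function.update_of_ne hne]
      exact ⟨ha, trivial, h3, h1, h.lt_clock _ ht⟩
    · rw [if_neg hva] at hv1
      obtain ⟨p1, p2, p3, p4, p5⟩ := h.parent v hv hv1
      have hne' : N.tl (par v) ≠ N.hd a := fun e => p4 (e ▸ h2)
      simp only [Function.update_of_ne hva, Function.update_of_ne hne']
      exact ⟨p1, p2, p3, p4, p5⟩

lemma runs_initMark {σ : State} (hσ : Stores N σ) :
    Runs initMark σ (14 * (N.n + 1)) fun τ =>
      ∀ v < N.n, τ.arr 5 v = if v ∈ N.S then 1 else 0 := by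
  refine Runs.forLoop (c := 4) (fun k τ => ∀ v < k, τ.arr 5 v = if v ∈ N.S then 1 else 0)
    rfl rfl (by decide) hσ.n (by simp) ?_ (fun τ _ h => h) (by omega)
  intro k hk τ hF hki hI
  have hτ := hσ.frame hF rfl
  refine Runs.of_run rfl le_rfl ?_
  intro v hv
  simp only [Prog.run, Expr.eval, hki, State.setReg_arr, State.setArr_arr, if_true,
    Function.update_apply]
  split_ifs with h h' h'
  · rw [hτ.S k hk, ← h, if_pos h']
  · rw [hτ.S k hk, ← h, if_neg h']
  · rw [hI v (by omega), if_pos h']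
  · rw [hI v (by omega), if_neg h']

/-- A pass over the arcs that marks nothing has verified closedness, and any other pass increases
the number of marked vertices. -/
lemma runs_scan {σ : State} (hσ : Stores N σ)
    (h : Marked N (σ.arr 4) M (σ.arr 5) (σ.arr 6) (σ.reg 5)) :
    Runs (.forLoop 3 2 scanArc) σ (40 * (N.A + 1)) fun τ =>
      Marked N (σ.arr 4) M (τ.arr 5) (τ.arr 6) (τ.reg 5) ∧
      ((τ.arr 5 = σ.arr 5 ∧ N.Closed (σ.arr 4) (support N.n (σ.arr 5))) ∨
        (support N.n (σ.arr 5)).card < (support N.n (τ.arr 5)).card) := by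
  refine Runs.forLoop (c := 30) (fun k τ => Marked N (σ.arr 4) M (τ.arr 5) (τ.arr 6) (τ.reg 5) ∧
      ((τ.arr 5 = σ.arr 5 ∧ ∀ a < k, σ.arr 4 a ≠ 0 → σ.arr 5 (N.tl a) ≠ 0 → σ.arr 5 (N.hd a) ≠ 0) ∨
        (support N.n (σ.arr 5)).card < (support N.n (τ.arr 5)).card))
    rfl rfl (by decide) hσ.A (by simpa using h) ?_ ?_ (by omega)
  · intro a ha τ hF hai hI
    have hτ := hσ.frame hF rfl
    have h4 : τ.arr 4 = σ.arr 4 := hF.arr 4 rfl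
    refine Runs.of_run rfl (by decide) ?_
    have hno : (σ.arr 4 a ≠ 0 → τ.arr 5 (N.tl a) ≠ 0 → τ.arr 5 (N.hd a) ≠ 0) →
        (τ.arr 5 = σ.arr 5 ∧ ∀ b < a + 1, σ.arr 4 b ≠ 0 → σ.arr 5 (N.tl b) ≠ 0 →
          σ.arr 5 (N.hd b) ≠ 0) ∨ (support N.n (σ.arr 5)).card < (support N.n (τ.arr 5)).card := by
      intro hh
      refine hI.2.imp (fun h' => ⟨h'.1, fun b hb => ?_⟩) id
      rcases Nat.lt_succ_iff_lt_or_eq.1 hb with hb | rfl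
      · exact h'.2 b hb
      · rwa [← h'.1]
    simp only [scanArc, Prog.run, Expr.eval, hai, hτ.tl a ha, hτ.hd a ha, h4]
    split_ifs with c1 c2 c3
    · exact ⟨by simpa using hI.1, hno fun _ _ => c2⟩
    · simp only [State.setReg_arr, State.setArr_arr, State.setReg_reg, State.setArr_reg]
      simp [hτ.hd a ha, hai]
      rw [not_not] at c2
      refine ⟨hI.1.mark ha c1 c2 c3, Or.inr ?_⟩
      rw [card_support_update (N.hd_lt ha) c2 (by have := hI.1.clock_two; omega)]
      rcases hI.2 with h' | h'
      · rw [h'.1]; omega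
      · omega
    · exact ⟨by simpa using hI.1, hno fun h0 => absurd h0 c3⟩
    · exact ⟨by simpa using hI.1, hno fun _ h0 => absurd h0 c1⟩
  · intro τ _ hI
    refine ⟨hI.1, hI.2.imp (fun h' => ⟨h'.1, fun a ha h1 h2 => ?_⟩) id⟩
    rw [mem_support] at h2 ⊢
    exact ⟨N.hd_lt ha, h'.2 a ha h1 h2.2⟩

/-- Each pass before closedness marks a further vertex, so after `N.n` passes the marked set is
closed or consists of all vertices, and then is closed as well. -/
lemma runs_search {σ : State} (hσ : Stores N σ) (hM : M ⊆ Finset.range N.n)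
    (h : ∀ v < N.n, σ.arr 5 v = if v ∈ M then 1 else 0) :
    Runs search σ (100 * (N.n + 1) * (N.A + 1)) fun τ =>
      Marked N (σ.arr 4) M (τ.arr 5) (τ.arr 6) (τ.reg 5) ∧
        N.Closed (σ.arr 4) (support N.n (τ.arr 5)) := by
  have hs : support N.n (σ.arr 5) = M := by
    ext v
    rw [mem_support]
    constructor
    · rintro ⟨hv, h1⟩
      by_contra h2
      exact h1 (by rw [h v hv, if_neg h2])
    · intro hv
      have hv' := Finset.mem_range.1 (hM hv)
      exact ⟨hv', by rw [h v hv', if_pos hv]; exact one_ne_zero⟩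
  have h0 : Marked N (σ.arr 4) M (σ.arr 5) (σ.arr 6) 2 := by
    refine ⟨le_rfl, by omega, ?_, ?_, ?_, ?_⟩
    · intro v hv; rw [h v hv]; split_ifs <;> simp_all
    · intro v hv; rw [h v hv]; split_ifs <;> simp
    · intro C _ hMC; rwa [hs]
    · intro v hv h1; rw [h v hv] at h1; split_ifs at h1 <;> omega
  refine Runs.run_seq (2 + (N.n + 1) * (40 * (N.A + 1) + 8)) rfl ?_
    (by simp only [Prog.time, Expr.cost]; nlinarith)
  have hσ' : Stores N ((Prog.set 5 (.const 2)).run σ) := by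
    obtain ⟨t, -, ht⟩ := exec_run (P := .set 5 (.const 2)) rfl σ
    exact hσ.frame ht.frame rfl
  have e4 : ((Prog.set 5 (.const 2)).run σ).arr 4 = σ.arr 4 := rfl
  refine Runs.forLoop (fun k τ => Marked N (σ.arr 4) M (τ.arr 5) (τ.arr 6) (τ.reg 5) ∧
      (N.Closed (σ.arr 4) (support N.n (τ.arr 5)) ∨ k ≤ (support N.n (τ.arr 5)).card))
    rfl rfl (by decide) hσ'.n ?_ ?_ ?_ le_rfl
  · exact ⟨by simpa [Prog.run, Expr.eval] using h0, Or.inr (Nat.zero_le _)⟩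
  · intro k hk τ hF hki hI
    have h4 : τ.arr 4 = σ.arr 4 := hF.arr 4 rfl
    refine (runs_scan (hσ'.frame hF rfl) (M := M) (by rw [h4]; exact hI.1)).mono le_rfl ?_
    intro τ' hF' h'
    rw [h4] at h'
    refine ⟨by simpa using h'.1, ?_⟩
    simp only [State.setReg_arr]
    rcases h'.2 with ⟨h5, h6⟩ | h5
    · exact Or.inl (h5 ▸ h6)
    · rcases hI.2 with h6 | h6
      -- If the marked set was closed already, soundness keeps the later marks inside it, so it
      -- cannot have grown.
      · have hsub : M ⊆ support N.n (τ.arr 5) := by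
          intro v hv
          have hv' := Finset.mem_range.1 (hM hv)
          exact mem_support.2 ⟨hv', by rw [(hI.1.start v hv').2 hv]; exact one_ne_zero⟩
        have := Finset.card_le_card (h'.1.sound _ h6 hsub)
        omega
      · right; omega
  · intro τ _ hI
    refine ⟨hI.1, hI.2.elim id fun h' => ?_⟩
    have : support N.n (τ.arr 5) = Finset.range N.n :=
      Finset.eq_of_subset_of_card_le (Finset.filter_subset _ _) (by simpa using h')
    intro a ha _ _
    rw [this]
    exact Finset.mem_range.2 (N.hd_lt ha)

lemma Marked.start_subset {mark par : ℕ → ℕ} {clock : ℕ} (h : Marked N r M mark par clock)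
    (hM : M ⊆ Finset.range N.n) : M ⊆ support N.n mark := by
  intro v hv
  have hv' := Finset.mem_range.1 (hM hv)
  exact mem_support.2 ⟨hv', by rw [(h.start v hv').2 hv]; exact one_ne_zero⟩

end CountCuts

/-! ## Maximum flow -/

namespace CountCuts

open RAM

variable {N : Network} {r : ℕ → ℕ} {M : Finset ℕ}

lemma val_push {a : ℕ} (ha : a < N.A) (h : r a ≠ 0) :
    N.val (N.push r a) =
      N.val r + (if N.tl a ∈ N.S then 1 else 0) - (if N.hd a ∈ N.S then 1 else 0) := by
  unfold Network.val
  simp only [Network.net_push ha h, Finset.sum_add_distrib, Finset.sum_sub_distrib,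
    Finset.sum_ite_eq]

lemma runs_findTarget {σ : State} (hσ : Stores N σ) :
    Runs findTarget σ (30 * (N.n + 1)) fun τ =>
      (τ.reg 7 = 0 ∧ ∀ v < N.n, σ.arr 5 v ≠ 0 → v ∉ N.T) ∨
        ∃ t < N.n, τ.reg 7 = t + 1 ∧ t ∈ N.T ∧ σ.arr 5 t ≠ 0 := by
  refine Runs.run_seq (2 + (N.n + 1) * (10 + 8)) rfl ?_
    (by simp only [Prog.time, Expr.cost]; omega)
  have hσ' : Stores N ((Prog.set 7 (.const 0)).run σ) := by
    obtain ⟨t, -, ht⟩ := exec_run (P := .set 7 (.const 0)) rfl σ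
    exact hσ.frame ht.frame rfl
  refine Runs.forLoop (fun k τ => (τ.reg 7 = 0 ∧ ∀ v < k, σ.arr 5 v ≠ 0 → v ∉ N.T) ∨
        ∃ t < N.n, τ.reg 7 = t + 1 ∧ t ∈ N.T ∧ σ.arr 5 t ≠ 0)
    rfl rfl (by decide) hσ'.n ?_ ?_ (fun _ _ h => h) le_rfl
  · left
    simp [Prog.run, Expr.eval]
  · intro v hv τ hF hvi hI
    have hτ := hσ'.frame hF rfl
    have h5 : τ.arr 5 = σ.arr 5 := hF.arr 5 rfl
    refine Runs.of_run rfl (by decide) ?_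
    have hno : (σ.arr 5 v ≠ 0 → v ∉ N.T) →
        (τ.reg 7 = 0 ∧ ∀ u < v + 1, σ.arr 5 u ≠ 0 → u ∉ N.T) ∨
          ∃ t < N.n, τ.reg 7 = t + 1 ∧ t ∈ N.T ∧ σ.arr 5 t ≠ 0 := by
      intro hh
      refine hI.imp (fun h' => ⟨h'.1, fun u hu => ?_⟩) id
      rcases Nat.lt_succ_iff_lt_or_eq.1 hu with hu | rfl
      · exact h'.2 u hu
      · exact hh
    simp only [Prog.run, Expr.eval, hvi, h5]
    split_ifs with c1 c2
    · exact Or.inr ⟨v, hv, by simp, (hτ.T v hv).1 c1, c2⟩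
    · simpa using hno fun h => absurd h c2
    · simpa using hno fun _ h => c1 ((hτ.T v hv).2 h)

/-- The state while a path is followed backwards from a target to the vertex `v`. -/
structure Backtrack (N : Network) (r₀ r mark par : ℕ → ℕ) (v : ℕ) : Prop where
  lt : v < N.n
  marked : mark v ≠ 0
  balanced : N.Balanced r
  net : ∀ x, x ∉ N.S → x ∉ N.T → N.net r x = if v = x then 1 else 0
  val : N.val r = N.val r₀ + if v ∈ N.S then 1 else 0
  residual : ∀ x < N.n, 1 < mark x → mark x ≤ mark v → r (par x) ≠ 0

/-- Marks decrease along the path, so the parent arcs still to be used differ from the one just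
used. Their residual capacities do not decrease; one grows if it is the opposite arc. -/
lemma Backtrack.step {r₀ mark par : ℕ → ℕ} {clock v : ℕ} (hm : Marked N r₀ M mark par clock)
    (h : Backtrack N r₀ r mark par v) (hv : 1 < mark v) :
    Backtrack N r₀ (N.push r (par v)) mark par (N.tl (par v)) := by
  obtain ⟨p1, p2, p3, p4, p5⟩ := hm.parent v h.lt hv
  have hr := h.residual v h.lt hv le_rfl
  constructor
  · exact N.tl_lt _ p1
  · exact p4
  · exact h.balanced.push p1 hr
  · intro x hS hT
    rw [Network.net_push p1 hr, h.net x hS hT, p2]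
    ring
  · rw [val_push p1 hr, h.val, p2]
    ring
  · intro x hx hx1 hxu
    obtain ⟨q1, q2, q3, q4, q5⟩ := hm.parent x hx hx1
    have hne : par x ≠ par v := by
      intro e
      rw [e, p2] at q2
      subst q2
      omega
    have := h.residual x hx hx1 (by omega)
    rw [Network.push_apply, if_neg hne]
    split_ifs
    · omega
    · exact this

lemma runs_stepBack {σ : State} (hσ : Stores N σ) {v : ℕ} (hv : σ.reg 7 = v)
    (hp : σ.arr 6 v < N.A) : Runs stepBack σ 30 fun τ =>
      τ.reg 7 = N.tl (σ.arr 6 v) ∧ τ.arr 4 = N.push (σ.arr 4) (σ.arr 6 v) := by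
  refine Runs.of_run rfl (by decide) ?_
  have h1 := N.rev_ne _ hp
  simp [stepBack, Prog.run, Expr.eval, hv, hσ.tl _ hp, hσ.rev _ hp, Network.push, h1]

lemma runs_augment {σ : State} (hσ : Stores N σ) {t : ℕ} (ht : σ.reg 7 = t) (htn : t < N.n)
    (htT : t ∈ N.T) (hmt : σ.arr 5 t ≠ 0) (hr : N.IsFlow (σ.arr 4))
    (hm : Marked N (σ.arr 4) N.S (σ.arr 5) (σ.arr 6) (σ.reg 5)) :
    Runs augment σ (40 * (N.n + 2)) fun τ =>
      N.IsFlow (τ.arr 4) ∧ N.val (τ.arr 4) = N.val (σ.arr 4) + 1 := by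
  -- The mark of the current vertex is the loop variant; marks are below the clock, which is at most
  -- the number of marked vertices plus `2`.
  have hb : σ.arr 5 t + 1 ≤ N.n + 2 := by
    have h1 := hm.lt_clock t htn
    have h2 := hm.clock_le
    have h3 := card_support_le N.n (σ.arr 5)
    omega
  refine Runs.loop (c := 30) (fun k τ => ∃ v, τ.reg 7 = v ∧ k = σ.arr 5 v ∧ Stores N τ ∧
    τ.arr 5 = σ.arr 5 ∧ τ.arr 6 = σ.arr 6 ∧
    Backtrack N (σ.arr 4) (τ.arr 4) (σ.arr 5) (σ.arr 6) v) (σ.arr 5 t) ?_ ?_ ?_ ?_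
  · have htS : t ∉ N.S := fun h => Finset.disjoint_left.1 N.disj h htT
    refine ⟨t, ht, rfl, hσ, rfl, rfl, htn, hmt, hr.balanced, ?_, by simp [htS], ?_⟩
    · intro x hS hT
      rw [hr.conserve x hS hT, if_neg]
      rintro rfl
      exact hT htT
    · intro x hx hx1 _
      exact (hm.parent x hx hx1).2.2.1
  · rintro _ τ ⟨v, hv, rfl, hτ, h5, h6, hB⟩ he
    have hv1 : 1 < σ.arr 5 v := by
      simp only [Expr.eval, hv, h5] at he
      omega
    have hp := hm.parent v hB.lt hv1
    refine (runs_stepBack hτ hv (h6 ▸ hp.1)).mono le_rfl fun τ' hF h => ?_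
    rw [h6] at h
    refine ⟨_, hp.2.2.2.2, _, h.1, rfl, hτ.frame hF rfl, ?_, ?_, ?_⟩
    · rw [hF.arr 5 rfl, h5]
    · rw [hF.arr 6 rfl, h6]
    · rw [h.2]
      exact hB.step hm hv1
  · rintro _ τ ⟨v, hv, rfl, hτ, h5, h6, hB⟩ he
    have hv1 : σ.arr 5 v = 1 := by
      simp only [Expr.eval, hv, h5] at he
      have := hB.marked
      omega
    have hvS := (hm.start v hB.lt).1 hv1
    refine ⟨⟨hB.balanced, fun x hS hT => ?_⟩, by rw [hB.val, if_pos hvS]⟩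
    rw [hB.net x hS hT, if_neg]
    rintro rfl
    exact hS hvS
  · simp only [Expr.cost]
    nlinarith

/-- The residual capacities in array `4` are those of a maximum flow, and the vertices that are
reachable from the sources are marked. -/
structure Maximal (N : Network) (σ : State) : Prop where
  flow : N.IsFlow (σ.arr 4)
  closed : N.Closed (σ.arr 4) (support N.n (σ.arr 5))
  least : ∀ C, N.Closed (σ.arr 4) C → N.S ⊆ C → support N.n (σ.arr 5) ⊆ C
  separates : N.Separates (support N.n (σ.arr 5))

lemma runs_maxFlow_body {σ : State} (hσ : Stores N σ) (hr : N.IsFlow (σ.arr 4)) :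
    Runs (initMark ;; search ;; findTarget ;;
      .ite (.reg 7) (.set 7 (.sub (.reg 7) (.const 1)) ;; augment) (.set 8 (.const 0))) σ
      (240 * (N.n + 1) * (N.A + 1)) fun τ =>
        (τ.reg 8 = σ.reg 8 ∧ N.IsFlow (τ.arr 4) ∧ N.val (τ.arr 4) = N.val (σ.arr 4) + 1) ∨
          (τ.reg 8 = 0 ∧ Maximal N τ) := by
  refine Runs.seq _ (100 * (N.n + 1) * (N.A + 1) + (30 * (N.n + 1) + (40 * (N.n + 2) + 6)))
    (runs_initMark hσ) (fun τ₁ F₁ h₁ => ?_) (by nlinarith [Nat.zero_le (N.n * N.A)])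
  have hσ₁ := hσ.frame F₁ rfl
  refine Runs.seq _ _ (runs_search hσ₁ N.S_sub h₁) (fun τ₂ F₂ h₂ => ?_) le_rfl
  have hσ₂ := hσ₁.frame F₂ rfl
  have e₂ : τ₂.arr 4 = σ.arr 4 := by rw [F₂.arr 4 rfl, F₁.arr 4 rfl]
  rw [F₁.arr 4 rfl] at h₂
  refine Runs.seq _ _ (runs_findTarget hσ₂) (fun τ₃ F₃ h₃ => ?_) le_rfl
  have hσ₃ := hσ₂.frame F₃ rfl
  have e₃ : τ₃.arr 4 = σ.arr 4 := by rw [F₃.arr 4 rfl, e₂]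
  have e8 : τ₃.reg 8 = σ.reg 8 := by rw [F₃.reg 8 rfl, F₂.reg 8 rfl, F₁.reg 8 rfl]
  have e5 : τ₃.arr 5 = τ₂.arr 5 := F₃.arr 5 rfl
  have e6 : τ₃.arr 6 = τ₂.arr 6 := F₃.arr 6 rfl
  have c5 : τ₃.reg 5 = τ₂.reg 5 := F₃.reg 5 rfl
  refine Runs.ite (40 * (N.n + 2) + 4) (fun h7 => ?_) (fun h7 => ?_) (by simp [Expr.cost]; omega)
  · obtain ⟨h, -⟩ | ⟨t, htn, ht, htT, hmt⟩ := h₃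
    · exact absurd h h7
    refine Runs.run_seq (40 * (N.n + 2)) rfl ?_ (by simp only [Prog.time, Expr.cost]; omega)
    have hσ₄ : Stores N ((Prog.set 7 (.sub (.reg 7) (.const 1))).run τ₃) := by
      obtain ⟨t, -, ht⟩ := exec_run (P := .set 7 (.sub (.reg 7) (.const 1))) rfl τ₃
      exact hσ₃.frame ht.frame rfl
    refine (runs_augment hσ₄ (t := t) (by simp [Prog.run, Expr.eval, ht]) htn htT
      (by simpa [Prog.run, e5] using hmt) (by simpa [Prog.run, e₃] using hr)
      (by simpa [Prog.run, e₃, e5, e6, c5] using h₂.1)).mono le_rfl fun τ F h => Or.inl ?_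
    refine ⟨?_, h.1, ?_⟩
    · rw [F.reg 8 rfl]
      simp [Prog.run, e8]
    · rw [h.2]
      simp [Prog.run, e₃]
  · obtain ⟨-, h⟩ | ⟨t, htn, ht, htT, hmt⟩ := h₃
    swap
    · simp [Expr.eval, ht] at h7
    refine Runs.of_run rfl (by simp only [Prog.time, Expr.cost]; omega) (Or.inr ?_)
    simp only [Prog.run, Expr.eval, State.setReg_reg, if_true, true_and]
    refine ⟨by simpa [e₃] using hr, by simpa [e₃, e5] using h₂.2,
      by simpa [e₃, e5] using h₂.1.sound, ?_, ?_⟩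
    · simpa [e5] using h₂.1.start_subset N.S_sub
    · rw [Finset.disjoint_left]
      intro v hv
      simp only [State.setReg_arr, e5] at hv
      exact h v (mem_support.1 hv).1 (mem_support.1 hv).2

/-- All capacities equal to `1` represent the zero flow, and every successful round raises the
value, which never exceeds `K`. -/
lemma runs_maxFlow {σ : State} {K : ℕ} (hσ : Stores N σ) (h1 : ∀ a < N.A, σ.arr 4 a = 1)
    (hK : ∀ r, N.IsFlow r → N.val r ≤ K) :
    Runs maxFlow σ (250 * (K + 2) * (N.n + 1) * (N.A + 1)) (Maximal N) := by
  have hnet : ∀ v, N.net (σ.arr 4) v = 0 := by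
    intro v
    refine Finset.sum_eq_zero fun a ha => ?_
    rw [h1 a (Finset.mem_range.1 (Finset.mem_filter.1 ha).1)]
    rfl
  have hr : N.IsFlow (σ.arr 4) :=
    ⟨fun a ha => by rw [h1 a ha, h1 _ (N.rev_lt a ha)], fun v _ _ => hnet v⟩
  have hval : N.val (σ.arr 4) = 0 := Finset.sum_eq_zero fun v _ => hnet v
  refine Runs.run_seq ((K + 1 + 1) * (240 * (N.n + 1) * (N.A + 1) + 1 + 1)) rfl ?_ ?_
  swap
  · simp only [Prog.time, Expr.cost]
    have : 1 ≤ (N.n + 1) * (N.A + 1) := Nat.mul_pos (by omega) (by omega)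
    have h2 : (K + 2) * 1 ≤ (K + 2) * ((N.n + 1) * (N.A + 1)) := Nat.mul_le_mul_left _ this
    ring_nf at h2 ⊢
    omega
  -- The variant is `K + 1` minus the value, hence positive before every round; the last round,
  -- which finds no target, lowers it to `0`.
  refine Runs.loop (c := 240 * (N.n + 1) * (N.A + 1)) (fun k τ => Stores N τ ∧
    ((τ.reg 8 ≠ 0 ∧ N.IsFlow (τ.arr 4) ∧ k + N.val (τ.arr 4) = K + 1) ∨
      (τ.reg 8 = 0 ∧ k = 0 ∧ Maximal N τ))) (K + 1) ?_ ?_ ?_ le_rfl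
  · refine ⟨?_, Or.inl ⟨by simp [Prog.run, Expr.eval], by simpa [Prog.run] using hr, ?_⟩⟩
    · obtain ⟨t, -, ht⟩ := exec_run (P := .set 8 (.const 1)) rfl σ
      exact hσ.frame ht.frame rfl
    · simp [Prog.run, hval]
  · rintro k τ ⟨hτ, ⟨h8, hf, hk⟩ | ⟨h8, -⟩⟩ he
    swap
    · exact absurd h8 he
    have hk1 := hK _ hf
    refine (runs_maxFlow_body hτ hf).mono le_rfl fun τ' F h => ?_
    obtain ⟨h8', hf', hv'⟩ | ⟨h8', hm⟩ := h
    · exact ⟨k - 1, by omega, hτ.frame F rfl, Or.inl ⟨by rwa [h8'], hf', by omega⟩⟩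
    · exact ⟨0, by omega, hτ.frame F rfl, Or.inr ⟨h8', rfl, hm⟩⟩
  · rintro k τ ⟨hτ, ⟨h8, -⟩ | ⟨h8, -, hm⟩⟩ he
    · exact absurd he h8
    · exact hm

end CountCuts

/-! ## Ranks in finite sets -/

/-- The number of smaller elements. -/
def rank (J : Finset ℕ) (a : ℕ) : ℕ := (J.filter (· < a)).card

lemma filter_lt_succ (J : Finset ℕ) (a : ℕ) :
    J.filter (· < a + 1) = if a ∈ J then insert a (J.filter (· < a)) else J.filter (· < a) := by
  ext b
  split_ifs with h
  · simp only [Finset.mem_filter, Finset.mem_insert, Nat.lt_succ_iff_lt_or_eq]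
    constructor
    · rintro ⟨h1, h2 | h2⟩
      · exact Or.inr ⟨h1, h2⟩
      · exact Or.inl h2
    · rintro (rfl | h1)
      · exact ⟨h, Or.inr rfl⟩
      · exact ⟨h1.1, Or.inl h1.2⟩
  · simp only [Finset.mem_filter, Nat.lt_succ_iff_lt_or_eq]
    constructor
    · rintro ⟨h1, h2 | rfl⟩
      · exact ⟨h1, h2⟩
      · exact absurd h1 h
    · rintro h1
      exact ⟨h1.1, Or.inl h1.2⟩

/-- Loops scan the arcs in increasing order, so a counter of the arcs of `J` met so far holds the
rank of the current one. -/
lemma rank_succ_of_mem {J : Finset ℕ} {a : ℕ} (h : a ∈ J) : rank J (a + 1) = rank J a + 1 := by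
  rw [rank, filter_lt_succ, if_pos h, Finset.card_insert_of_notMem (by simp)]
  rfl

lemma rank_succ_of_notMem {J : Finset ℕ} {a : ℕ} (h : a ∉ J) : rank J (a + 1) = rank J a := by
  rw [rank, filter_lt_succ, if_neg h]
  rfl

lemma rank_zero (J : Finset ℕ) : rank J 0 = 0 := by simp [rank]

lemma filter_lt_eq_self {J : Finset ℕ} {A : ℕ} (h : J ⊆ Finset.range A) :
    J.filter (· < A) = J :=
  Finset.filter_true_of_mem fun _ ha => Finset.mem_range.1 (h ha)

lemma rank_eq_card {J : Finset ℕ} {A : ℕ} (h : J ⊆ Finset.range A) : rank J A = J.card := by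
  rw [rank, filter_lt_eq_self h]

lemma rank_strictMono {J : Finset ℕ} {a b : ℕ} (ha : a ∈ J) (h : a < b) : rank J a < rank J b := by
  refine Finset.card_lt_card (Finset.ssubset_iff_of_subset ?_ |>.2 ⟨a, by simp [ha, h], by simp⟩)
  intro x
  simp only [Finset.mem_filter]
  exact fun hx => ⟨hx.1, hx.2.trans h⟩

lemma rank_injOn (J : Finset ℕ) : Set.InjOn (rank J) J := by
  intro a ha b hb h
  rcases lt_trichotomy a b with hab | hab | hab
  · exact absurd h (rank_strictMono ha hab).ne
  · exact hab
  · exact absurd h (rank_strictMono hb hab).ne'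

lemma rank_lt_card {J : Finset ℕ} {a : ℕ} (ha : a ∈ J) : rank J a < J.card :=
  Finset.card_lt_card (Finset.filter_ssubset.2 ⟨a, ha, lt_irrefl a⟩)

lemma image_rank (J : Finset ℕ) : J.image (rank J) = Finset.range J.card := by
  refine Finset.eq_of_subset_of_card_le ?_ ?_
  · intro i hi
    obtain ⟨a, ha, rfl⟩ := Finset.mem_image.1 hi
    exact Finset.mem_range.2 (rank_lt_card ha)
  · rw [Finset.card_image_of_injOn (rank_injOn J), Finset.card_range]

lemma exists_rank_eq {J : Finset ℕ} {i : ℕ} (hi : i < J.card) : ∃ a ∈ J, rank J a = i :=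
  Finset.mem_image.1 (image_rank J ▸ Finset.mem_range.2 hi)

lemma sum_rank (J : Finset ℕ) (f : ℕ → ℕ) :
    ∑ a ∈ J, f (rank J a) = ∑ i ∈ Finset.range J.card, f i := by
  rw [← image_rank, Finset.sum_image (rank_injOn J)]

/-- The elements of `O` inherit the weights of the elements of `J` of the same rank. -/
lemma BinaryWeights.inherit {w w' q : ℕ → ℕ} {D J O : Finset ℕ} {k : ℕ} (h : BinaryWeights w D k)
    (hJ : J ⊆ D) (hc : O.card = J.card) (hq : ∀ a ∈ J, q (rank J a) = a)
    (hw : ∀ a ∉ O, w' a = w a) (hwO : ∀ a ∈ O, w' a = w (q (rank O a))) :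
    BinaryWeights w' (D \ J ∪ O) k ∧ ∑ a ∈ O, w' a = ∑ a ∈ J, w a := by
  have hqO : ∀ a ∈ O, q (rank O a) ∈ J ∧ rank J (q (rank O a)) = rank O a := by
    intro a ha
    obtain ⟨b, hb, hab⟩ := exists_rank_eq (J := J) (hc ▸ rank_lt_card ha)
    rw [← hab, hq b hb]
    exact ⟨hb, rfl⟩
  constructor
  · obtain ⟨l, h1, h2⟩ := h
    -- Each arc of `O` gets the exponent of the arc of `J` of equal rank. A clash with an exponent
    -- of `D \ J` would contradict injectivity on `D`.
    refine ⟨fun a => if a ∈ O then l (q (rank O a)) else l a, ?_, ?_⟩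
    · intro a ha
      dsimp only
      split_ifs with haO
      · rw [hwO a haO]
        exact h1 _ (hJ (hqO a haO).1)
      · rw [hw a haO]
        simp only [Finset.mem_union, Finset.mem_sdiff, haO, or_false] at ha
        exact h1 a ha.1
    · intro a ha b hb hab
      simp only [Finset.coe_union, Finset.coe_sdiff, Set.mem_union, Set.mem_sdiff,
        Finset.mem_coe] at ha hb
      dsimp only at hab
      split_ifs at hab with haO hbO hbO
      · have := h2 (hJ (hqO a haO).1) (hJ (hqO b hbO).1) hab
        refine rank_injOn O haO hbO ?_
        rw [← (hqO a haO).2, this, (hqO b hbO).2]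
      · have hb' := hb.resolve_right hbO
        have := h2 (hJ (hqO a haO).1) hb'.1 hab
        exact absurd (this ▸ (hqO a haO).1) hb'.2
      · have ha' := ha.resolve_right haO
        have := h2 ha'.1 (hJ (hqO b hbO).1) hab
        exact absurd (this ▸ (hqO b hbO).1) ha'.2
      · exact h2 (ha.resolve_right haO).1 (hb.resolve_right hbO).1 hab
  · rw [Finset.sum_congr rfl hwO, sum_rank O fun i => w (q i), hc, ← sum_rank J fun i => w (q i)]
    exact Finset.sum_congr rfl fun a ha => by rw [hq a ha]

lemma sum_two_pow_rank (J : Finset ℕ) : ∑ a ∈ J, 2 ^ rank J a = 2 ^ J.card - 1 := by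
  rw [sum_rank J fun i => 2 ^ i, Nat.geomSum_eq le_rfl]
  simp

namespace CountCuts

open RAM

variable {N : Network} {r : ℕ → ℕ} {σ : State}

lemma Stores.run (h : Stores N σ) {P : Prog} (hP : P.loopFree = true)
    (hk : keepsInput P = true) : Stores N (P.run σ) := by
  obtain ⟨t, -, ht⟩ := exec_run hP σ
  exact h.frame ht.frame hk

/-! ## The loops that handle sets and tables -/

lemma runs_absorb (hσ : Stores N σ) :
    Runs absorb σ (30 * (N.n + 1)) fun τ =>
      support N.n (τ.arr 7) = support N.n (σ.arr 7) ∪ support N.n (σ.arr 5) := by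
  refine Runs.forLoop (c := 10) (fun k τ => ∀ v < N.n, τ.arr 7 v ≠ 0 ↔
      σ.arr 7 v ≠ 0 ∨ (v < k ∧ σ.arr 5 v ≠ 0)) rfl rfl (by decide) hσ.n ?_ ?_ ?_ (by omega)
  · simp
  · intro k hk τ hF hki hI
    have h5 : τ.arr 5 = σ.arr 5 := hF.arr 5 rfl
    refine Runs.of_run rfl (by decide) fun v hv => ?_
    have := hI v hv
    simp only [Prog.run, Expr.eval, hki, h5]
    split_ifs with c1
    · simp only [State.setReg_arr, State.setArr_arr, if_true, Function.update_apply]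
      split_ifs with c2
      · subst c2
        simp only [ne_eq, one_ne_zero, not_false_iff, true_iff]
        exact Or.inr ⟨by omega, c1⟩
      · rw [this, show v < k + 1 ↔ v < k by omega]
    · rw [State.setReg_arr, this]
      by_cases c2 : v = k
      · subst c2
        simp only [c1, and_false]
      · rw [show v < k + 1 ↔ v < k by omega]
  · intro τ _ h
    ext v
    simp only [mem_support, Finset.mem_union]
    constructor
    · rintro ⟨hv, h1⟩
      exact ((h v hv).1 h1).imp (fun h2 => ⟨hv, h2⟩) (fun h2 => h2)
    · rintro (⟨hv, h1⟩ | ⟨hv, h1⟩)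
      · exact ⟨hv, (h v hv).2 (Or.inl h1)⟩
      · exact ⟨hv, (h v hv).2 (Or.inr ⟨hv, h1⟩)⟩

lemma card_support_succ (k : ℕ) (f : ℕ → ℕ) :
    (support (k + 1) f).card = (support k f).card + if f k ≠ 0 then 1 else 0 := by
  rw [support, Finset.range_add_one, Finset.filter_insert]
  split_ifs with h
  · rw [Finset.card_insert_of_notMem (by simp)]; rfl
  · rfl

lemma runs_countMarked (hσ : Stores N σ) :
    Runs countMarked σ (40 * (N.n + 1)) fun τ =>
      τ.reg 12 = (support N.n (σ.arr 5)).card ∧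
        (τ.reg 13 = 0 ↔ Disjoint (support N.n (σ.arr 5)) N.T) := by
  refine Runs.run_seq (2 + (2 + (N.n + 1) * (20 + 8))) rfl ?_
    (by simp only [Prog.time, Expr.cost]; omega)
  refine Runs.run_seq (2 + (N.n + 1) * (20 + 8)) rfl ?_
    (by simp only [Prog.time, Expr.cost]; omega)
  have hσ' := (hσ.run (P := .set 12 (.const 0)) rfl rfl).run (P := .set 13 (.const 0)) rfl rfl
  refine Runs.forLoop (fun k τ => τ.reg 12 = (support k (σ.arr 5)).card ∧
      (τ.reg 13 = 0 ↔ ∀ v < k, σ.arr 5 v ≠ 0 → v ∉ N.T)) rfl rfl (by decide) hσ'.n ?_ ?_ ?_ le_rfl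
  · simp [Prog.run, Expr.eval, support]
  · intro v hv τ hF hvi hI
    have hτ := hσ'.frame hF rfl
    have h5 : τ.arr 5 = σ.arr 5 := hF.arr 5 rfl
    refine Runs.of_run rfl (by decide) ?_
    have hT := hτ.T v hv
    have hsucc : (∀ u < v + 1, σ.arr 5 u ≠ 0 → u ∉ N.T) ↔
        (∀ u < v, σ.arr 5 u ≠ 0 → u ∉ N.T) ∧ (σ.arr 5 v ≠ 0 → v ∉ N.T) := by
      simp only [Nat.lt_succ_iff_lt_or_eq]
      constructor
      · exact fun h => ⟨fun u hu => h u (Or.inl hu), h v (Or.inr rfl)⟩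
      · rintro ⟨h1, h2⟩ u (hu | rfl)
        · exact h1 u hu
        · exact h2
    rw [hsucc, card_support_succ, ← hI.1, ← hI.2]
    simp only [Prog.run, Expr.eval, hvi, h5]
    by_cases c1 : σ.arr 5 v = 0
    · simp [c1]
    · by_cases c2 : τ.arr 3 v = 0
      · have : v ∉ N.T := fun h => hT.2 h c2
        simp [c1, c2, this, hvi]
      · have := hT.1 c2
        simp [c1, c2, this, hvi]
  · rintro τ _ ⟨h1, h2⟩
    refine ⟨h1, h2.trans ?_⟩
    rw [Finset.disjoint_left]
    simp only [mem_support, and_imp]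

lemma runs_copyTable {F : ℕ} (hF : σ.reg 9 = F) :
    Runs copyTable σ (20 * (F + 1)) fun τ => ∀ i < F, τ.arr 10 i = σ.arr 9 i := by
  refine Runs.forLoop (c := 4) (fun k τ => ∀ i < k, τ.arr 10 i = σ.arr 9 i)
    rfl rfl (by decide) hF (by simp) ?_ (fun _ _ h => h) (by omega)
  intro k hk τ hFr hki hI
  have h9 : τ.arr 9 = σ.arr 9 := hFr.arr 9 rfl
  refine Runs.of_run rfl le_rfl fun i hi => ?_
  simp only [Prog.run, Expr.eval, hki, h9, State.setReg_arr, State.setArr_arr, if_true,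
    Function.update_apply]
  split_ifs with h
  · rw [h]
  · exact hI i (by omega)

lemma succ_mod_eq {q k : ℕ} (hq : 0 < q) :
    (k + 1) % q = if q - (k % q + 1) ≠ 0 then k % q + 1 else 0 := by
  have h := Nat.mod_lt k hq
  rw [← Nat.mod_add_mod]
  split_ifs with h1
  · exact Nat.mod_eq_of_lt (by omega)
  · rw [show k % q + 1 = q by omega, Nat.mod_self]

lemma runs_splitTable {F w : ℕ} (hF : σ.reg 9 = F) (hw : σ.reg 18 = w) (hw0 : 0 < w) :
    Runs splitTable σ (60 * (F + 1)) fun τ =>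
      (∀ i < F, τ.arr 9 i = if i % (w + w) < w then σ.arr 9 i + σ.arr 9 (i + w) else 0) ∧
      (∀ i, F ≤ i → τ.arr 9 i = σ.arr 9 i) ∧
      (∀ i < F, τ.arr 10 i = if i % (w + w) < w then 0 else σ.arr 10 i) := by
  refine Runs.run_seq (2 + (F + 1) * (40 + 8)) rfl ?_
    (by simp only [Prog.time, Expr.cost]; omega)
  refine Runs.forLoop (N := F) (fun k τ => τ.reg 17 = k % (w + w) ∧
      (∀ i < k, τ.arr 9 i = if i % (w + w) < w then σ.arr 9 i + σ.arr 9 (i + w) else 0) ∧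
      (∀ i, k ≤ i → τ.arr 9 i = σ.arr 9 i) ∧
      (∀ i < k, τ.arr 10 i = if i % (w + w) < w then 0 else σ.arr 10 i) ∧
      (∀ i, k ≤ i → τ.arr 10 i = σ.arr 10 i))
    rfl rfl (by decide) (by simp [Prog.run, hF]) ?_ ?_ ?_ le_rfl
  · simp [Prog.run, Expr.eval]
  · rintro k hk τ hFr hki ⟨h17, h1, h2, h3, h4⟩
    have h18 : τ.reg 18 = w := by rw [hFr.reg 18 rfl]; simpa [Prog.run] using hw
    refine Runs.of_run rfl (by decide) ?_
    have hm := succ_mod_eq (q := w + w) (k := k) (by omega)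
    have e1 := h2 k le_rfl
    -- The update is in place: the entry at `k + w` is read before the loop overwrites it.
    have e2 := h2 (k + w) (by omega)
    have e3 := h4 k le_rfl
    simp only [Prog.run, Expr.eval, hki, h17, h18, e1, e2]
    have hset : ∀ (f g : ℕ → ℕ) (x : ℕ), (∀ i < k, f i = g i) → x = g k →
        ∀ i < k + 1, Function.update f k x i = g i := by
      intro f g x hfg hx i hi
      rw [Function.update_apply]
      split_ifs with hik
      · rw [hik, hx]
      · exact hfg i (by omega)
    have hrest : ∀ (f g : ℕ → ℕ) (x : ℕ), (∀ i, k ≤ i → f i = g i) →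
        ∀ i, k + 1 ≤ i → Function.update f k x i = g i := by
      intro f g x hfg i hi
      rw [Function.update_of_ne (by omega), hfg i (by omega)]
    by_cases hc : k % (w + w) < w
    · have hc1 : w - k % (w + w) ≠ 0 := by omega
      have hc2 : w + w - (k % (w + w) + 1) ≠ 0 := by omega
      rw [if_pos hc2] at hm
      simp only [ne_eq, hc1, not_false_eq_true, if_true, State.setArr_reg, State.setArr_arr,
        State.setReg_reg, State.setReg_arr, hki, h17, h18, hc2, hm, Nat.reduceEqDiff, if_false]
      refine ⟨trivial, hset _ _ _ h1 ?_, hrest _ _ _ h2, hset _ _ _ h3 ?_, hrest _ _ _ h4⟩ <;>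
        simp only [hc, if_true]
    · have hc1 : w - k % (w + w) = 0 := by omega
      have h10 : ∀ i < k + 1, τ.arr 10 i = if i % (w + w) < w then 0 else σ.arr 10 i := by
        intro i hi
        rcases Nat.lt_succ_iff_lt_or_eq.1 hi with hi | rfl
        · exact h3 i hi
        · rw [if_neg hc, e3]
      have hx : (0 : ℕ) = if k % (w + w) < w then σ.arr 9 k + σ.arr 9 (k + w) else 0 := by
        rw [if_neg hc]
      by_cases hc2 : w + w - (k % (w + w) + 1) = 0
      · simp only [ne_eq, hc2, not_true_eq_false, if_false] at hm
        simp only [ne_eq, hc1, not_true_eq_false, if_false, if_true, State.setArr_reg,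
          State.setArr_arr, State.setReg_reg, State.setReg_arr, hki, h17, h18, hc2, hm,
          Nat.reduceEqDiff]
        exact ⟨trivial, hset _ _ _ h1 hx, hrest _ _ _ h2, h10, fun i hi => h4 i (by omega)⟩
      · simp only [ne_eq, hc2, not_false_eq_true, if_true] at hm
        simp only [ne_eq, hc1, not_true_eq_false, if_false, if_true, State.setArr_reg,
          State.setArr_arr, State.setReg_reg, State.setReg_arr, hki, h17, h18, hc2, hm,
          Nat.reduceEqDiff, not_false_eq_true]
        exact ⟨trivial, hset _ _ _ h1 hx, hrest _ _ _ h2, h10, fun i hi => h4 i (by omega)⟩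
  · rintro τ _ ⟨-, h1, h2, h3, -⟩
    exact ⟨h1, h2, h3⟩

end CountCuts

/-- Lets the table in array `9` be described at all indices, so that a read at `i + w` needs no
range check. -/
lemma table_eq_zero {𝒳 : Finset (Finset ℕ)} {w : ℕ → ℕ} {D J : Finset ℕ} {k i : ℕ}
    (h : BinaryWeights w D k) (hi : 2 ^ k ≤ i) : table 𝒳 w D J i = 0 := by
  rw [table, Finset.card_eq_zero, Finset.filter_eq_empty_iff]
  rintro X - ⟨-, h2⟩
  have := h.code_lt X
  omega

/-! ### The arcs that enter and leave a block -/

namespace CountCuts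

open RAM

variable {N : Network} {r : ℕ → ℕ} {σ : State} {k : ℕ}

/-- The set of vertices in array `7`. -/
def side (N : Network) (σ : State) : Finset ℕ := support N.n (σ.arr 7)

/-- The set of marked vertices. -/
def marks (N : Network) (σ : State) : Finset ℕ := support N.n (σ.arr 5)

/-- The arcs that enter the newly marked vertices. -/
def entering (N : Network) (σ : State) : Finset ℕ :=
  N.out (side N σ) \ N.out (side N σ ∪ marks N σ)

/-- The arcs that leave the newly marked vertices. -/
def leaving (N : Network) (σ : State) : Finset ℕ :=
  N.out (side N σ ∪ marks N σ) \ N.out (side N σ)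

lemma mem_entering {a : ℕ} (ha : a < N.A) :
    a ∈ entering N σ ↔ σ.arr 7 (N.tl a) ≠ 0 ∧ σ.arr 7 (N.hd a) = 0 ∧ σ.arr 5 (N.hd a) ≠ 0 := by
  simp only [entering, side, marks, Finset.mem_sdiff, Network.mem_out, Finset.mem_union,
    mem_support, ha, N.tl_lt a ha, N.hd_lt ha, true_and]
  tauto

lemma mem_leaving {a : ℕ} (ha : a < N.A) :
    a ∈ leaving N σ ↔ σ.arr 5 (N.tl a) ≠ 0 ∧
      σ.arr 7 (N.tl a) + (σ.arr 7 (N.hd a) + σ.arr 5 (N.hd a)) = 0 := by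
  simp only [leaving, side, marks, Finset.mem_sdiff, Network.mem_out, Finset.mem_union,
    mem_support, ha, N.tl_lt a ha, N.hd_lt ha, true_and, Nat.add_eq_zero_iff]
  tauto

lemma out_subset_range (U : Finset ℕ) : N.out U ⊆ Finset.range N.A := Finset.filter_subset _ _

lemma entering_subset : entering N σ ⊆ N.out (side N σ) := Finset.sdiff_subset

lemma leaving_disjoint : Disjoint (leaving N σ) (N.out (side N σ)) := Finset.sdiff_disjoint

lemma runs_enterBlock {𝒳 : Finset (Finset ℕ)} (hσ : Stores N σ) (hF : σ.reg 9 = 2 ^ k)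
    (hw : BinaryWeights (σ.arr 8) (N.out (side N σ)) k)
    (h9 : ∀ i, σ.arr 9 i = table 𝒳 (σ.arr 8) (N.out (side N σ)) ∅ i)
    (h10 : ∀ i < 2 ^ k, σ.arr 10 i = table 𝒳 (σ.arr 8) (N.out (side N σ)) ∅ i) :
    Runs enterBlock σ (100 * (N.A + 1) * (2 ^ k + 1)) fun τ =>
      (∀ i, τ.arr 9 i =
        table 𝒳 (σ.arr 8) (N.out (side N σ) \ entering N σ) ∅ i) ∧
      (∀ i < 2 ^ k, τ.arr 10 i = table 𝒳 (σ.arr 8) (N.out (side N σ)) (entering N σ) i) ∧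
      τ.reg 14 = (entering N σ).card ∧
      ∀ a ∈ entering N σ, τ.arr 11 (rank (entering N σ) a) = a := by
  set J := entering N σ with hJ
  set D := N.out (side N σ) with hD
  have hJD : J ⊆ D := entering_subset
  have hJA : J ⊆ Finset.range N.A := hJD.trans (out_subset_range _)
  refine Runs.run_seq (2 + (N.A + 1) * (60 * (2 ^ k + 1) + 22 + 8)) rfl ?_
    (by simp only [Prog.time, Expr.cost]; nlinarith [Nat.zero_le (N.A * 2 ^ k)])
  have hσ' := hσ.run (P := .set 14 (.const 0)) rfl rfl
  -- The entering arcs below `a` are already forgotten in array `9` and required in array `10`. The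
  -- latter keeps the full index set `D`, since the leaving arcs will reuse the bits of `J`.
  refine Runs.forLoop (fun a τ =>
      (∀ i, τ.arr 9 i = table 𝒳 (σ.arr 8) (D \ J.filter (· < a)) ∅ i) ∧
      (∀ i < 2 ^ k, τ.arr 10 i = table 𝒳 (σ.arr 8) D (J.filter (· < a)) i) ∧
      τ.reg 14 = rank J a ∧ ∀ b ∈ J, b < a → τ.arr 11 (rank J b) = b)
    rfl rfl (by decide) hσ'.A ?_ ?_ ?_ le_rfl
  · simpa [Prog.run, Expr.eval, rank_zero] using ⟨h9, h10⟩
  · rintro a ha τ hFr hai ⟨i9, i10, i14, i11⟩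
    have hτ := hσ'.frame hFr rfl
    have e7 : τ.arr 7 = σ.arr 7 := hFr.arr 7 rfl
    have e5 : τ.arr 5 = σ.arr 5 := hFr.arr 5 rfl
    have e8 : τ.arr 8 = σ.arr 8 := hFr.arr 8 rfl
    have e9 : τ.reg 9 = 2 ^ k := by rw [hFr.reg 9 rfl]; exact hF
    have hmem := mem_entering (σ := σ) ha
    rw [← hJ] at hmem
    have hskip : a ∉ J → ∀ b, 1 ≤ b → Runs .skip τ b fun τ' =>
        (∀ i, (τ'.setReg 3 (a + 1)).arr 9 i =
          table 𝒳 (σ.arr 8) (D \ J.filter (· < a + 1)) ∅ i) ∧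
        (∀ i < 2 ^ k, (τ'.setReg 3 (a + 1)).arr 10 i =
          table 𝒳 (σ.arr 8) D (J.filter (· < a + 1)) i) ∧
        (τ'.setReg 3 (a + 1)).reg 14 = rank J (a + 1) ∧
        ∀ b ∈ J, b < a + 1 → (τ'.setReg 3 (a + 1)).arr 11 (rank J b) = b := by
      intro haJ b hb
      refine Runs.of_run rfl hb ?_
      rw [filter_lt_succ, if_neg haJ, rank_succ_of_notMem haJ]
      refine ⟨i9, i10, by simpa [Prog.run] using i14, fun b hbJ hb => i11 b hbJ ?_⟩
      rcases Nat.lt_succ_iff_lt_or_eq.1 hb with hb | rfl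
      · exact hb
      · exact absurd hbJ haJ
    refine Runs.ite (60 * (2 ^ k + 1) + 18) (fun c1 => ?_)
      (fun c1 => hskip (fun h => ?_) _ (by omega)) (by simp only [Expr.cost]; omega)
    swap
    · simp only [Expr.eval, hai, hτ.tl a ha, e7] at c1
      exact (hmem.1 h).1 c1
    refine Runs.ite (60 * (2 ^ k + 1) + 14) (fun c2 => hskip (fun h => ?_) _ (by omega))
      (fun c2 => ?_) (by simp only [Expr.cost]; omega)
    · simp only [Expr.eval, hai, hτ.hd a ha, e7] at c2
      exact c2 (hmem.1 h).2.1
    refine Runs.ite (60 * (2 ^ k + 1) + 10) (fun c3 => ?_)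
      (fun c3 => hskip (fun h => ?_) _ (by omega)) (by simp only [Expr.cost]; omega)
    swap
    · simp only [Expr.eval, hai, hτ.hd a ha, e5] at c3
      exact (hmem.1 h).2.2 c3
    have haJ : a ∈ J := by
      simp only [Expr.eval, hai, hτ.hd a ha, hτ.tl a ha, e5, e7] at c1 c2 c3
      exact hmem.2 ⟨c1, c2, c3⟩
    have haD : a ∈ D \ J.filter (· < a) := by simp [hJD haJ]
    have hw' : BinaryWeights (σ.arr 8) (D \ J.filter (· < a)) k := hw.subset Finset.sdiff_subset
    have hpos : 0 < σ.arr 8 a := by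
      obtain ⟨l, h1, -⟩ := hw
      rw [(h1 a (hJD haJ)).1]
      exact Nat.two_pow_pos _
    refine Runs.run_seq (60 * (2 ^ k + 1) + 7) rfl ?_ (by simp only [Prog.time, Expr.cost]; omega)
    refine Runs.run_seq (60 * (2 ^ k + 1) + 3) rfl ?_ (by simp only [Prog.time, Expr.cost]; omega)
    refine Runs.run_seq (60 * (2 ^ k + 1)) rfl ?_ (by simp only [Prog.time, Expr.cost]; omega)
    set τ₁ := (Prog.set 18 (.load 8 (.reg 3))).run ((Prog.set 14 (.add (.reg 14) (.const 1))).run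
      ((Prog.store 11 (.reg 14) (.reg 3)).run τ)) with hτ₁
    have f9 : τ₁.arr 9 = τ.arr 9 := by simp [hτ₁, Prog.run]
    have f10 : τ₁.arr 10 = τ.arr 10 := by simp [hτ₁, Prog.run]
    have f11 : τ₁.arr 11 = Function.update (τ.arr 11) (rank J a) a := by
      simp [hτ₁, Prog.run, Expr.eval, hai, i14]
    have f14 : τ₁.reg 14 = rank J a + 1 := by simp [hτ₁, Prog.run, Expr.eval, i14]
    have f18 : τ₁.reg 18 = σ.arr 8 a := by simp [hτ₁, Prog.run, Expr.eval, hai, e8]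
    have g9 : τ₁.reg 9 = 2 ^ k := by simp [hτ₁, Prog.run, e9]
    refine (runs_splitTable g9 f18 hpos).mono le_rfl ?_
    rintro τ' F' ⟨s9, s9', s10⟩
    have hD' : D \ J.filter (· < a + 1) = (D \ J.filter (· < a)).erase a := by
      rw [filter_lt_succ, if_pos haJ, Finset.sdiff_insert]
    simp only [State.setReg_arr, State.setReg_reg]
    refine ⟨fun i => ?_, fun i hi => ?_, ?_, ?_⟩
    · rw [hD']
      by_cases hi : i < 2 ^ k
      · rw [s9 i hi, f9, i9, i9, hw'.table_erase haD]
      · rw [s9' i (by omega), f9, i9, table_eq_zero hw' (by omega),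
          table_eq_zero (hw'.subset (Finset.erase_subset _ _)) (by omega)]
    · rw [s10 i hi, f10, i10 i hi, filter_lt_succ, if_pos haJ, hw.table_insert (hJD haJ)]
    · rw [if_neg (by decide), F'.reg 14 rfl, f14, rank_succ_of_mem haJ]
    · intro b hb hba
      rw [F'.arr 11 rfl, f11]
      rcases Nat.lt_succ_iff_lt_or_eq.1 hba with hba | rfl
      · rw [Function.update_of_ne (rank_strictMono hb hba).ne, i11 b hb hba]
      · rw [Function.update_self]
  · rintro τ _ ⟨i9, i10, i14, i11⟩
    rw [filter_lt_eq_self hJA] at i9 i10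
    exact ⟨i9, i10, by rw [i14, rank_eq_card hJA],
      fun a ha => i11 a ha (Finset.mem_range.1 (hJA ha))⟩

lemma runs_leaveBlock {J : Finset ℕ} (hσ : Stores N σ) (hJ : Disjoint J (leaving N σ))
    (hc : (leaving N σ).card = J.card) (h11 : ∀ a ∈ J, σ.arr 11 (rank J a) = a) :
    Runs leaveBlock σ (50 * (N.A + 1)) fun τ =>
      (∀ a ∈ leaving N σ, τ.arr 8 a = σ.arr 8 (σ.arr 11 (rank (leaving N σ) a))) ∧
      ∀ a ∉ leaving N σ, τ.arr 8 a = σ.arr 8 a := by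
  set O := leaving N σ with hO
  have hOA : O ⊆ Finset.range N.A := Finset.sdiff_subset.trans (out_subset_range _)
  -- The weights are copied from arcs of `J`, which are disjoint from `O` and so never overwritten
  -- by the loop.
  have hq : ∀ a ∈ O, σ.arr 11 (rank O a) ∉ O := by
    intro a ha
    obtain ⟨b, hb, hab⟩ := exists_rank_eq (J := J) (hc ▸ rank_lt_card ha)
    rw [← hab, h11 b hb]
    exact Finset.disjoint_left.1 hJ hb
  refine Runs.run_seq (2 + (N.A + 1) * (30 + 8)) rfl ?_
    (by simp only [Prog.time, Expr.cost]; omega)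
  have hσ' := hσ.run (P := .set 15 (.const 0)) rfl rfl
  refine Runs.forLoop (fun a τ => τ.reg 15 = rank O a ∧
      (∀ b ∈ O, b < a → τ.arr 8 b = σ.arr 8 (σ.arr 11 (rank O b))) ∧
      ∀ b, (b ∈ O → a ≤ b) → τ.arr 8 b = σ.arr 8 b)
    rfl rfl (by decide) hσ'.A ?_ ?_ ?_ le_rfl
  · simp [Prog.run, Expr.eval, rank_zero]
  · rintro a ha τ hFr hai ⟨i15, i1, i2⟩
    have hτ := hσ'.frame hFr rfl
    have e7 : τ.arr 7 = σ.arr 7 := hFr.arr 7 rfl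
    have e5 : τ.arr 5 = σ.arr 5 := hFr.arr 5 rfl
    have e11 : τ.arr 11 = σ.arr 11 := hFr.arr 11 rfl
    have hmem := mem_leaving (σ := σ) ha
    rw [← hO] at hmem
    have hno : a ∉ O → rank O a = rank O (a + 1) ∧
        (∀ b ∈ O, b < a + 1 → τ.arr 8 b = σ.arr 8 (σ.arr 11 (rank O b))) ∧
        ∀ b, (b ∈ O → a + 1 ≤ b) → τ.arr 8 b = σ.arr 8 b := by
      intro haO
      refine ⟨(rank_succ_of_notMem haO).symm, fun b hb hba => i1 b hb ?_, fun b hb => i2 b ?_⟩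
      · rcases Nat.lt_succ_iff_lt_or_eq.1 hba with h | rfl
        · exact h
        · exact absurd hb haO
      · exact fun h => (Nat.le_succ a).trans (hb h)
    refine Runs.of_run rfl (by decide) ?_
    simp only [Prog.run, Expr.eval, hai, hτ.tl a ha, hτ.hd a ha, e7, e5, e11]
    split_ifs with c1 c2
    · simpa [i15] using hno fun h => c2 (hmem.1 h).2
    · rw [not_not] at c2
      have haO := hmem.2 ⟨c1, c2⟩
      simp only [State.setReg_reg, State.setReg_arr, State.setArr_reg, State.setArr_arr, i15,
        rank_succ_of_mem haO, if_true, if_false, Nat.reduceEqDiff, true_and]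
      rw [i2 _ fun h => absurd h (hq a haO)]
      constructor
      · intro b hb hba
        rw [Function.update_apply]
        split_ifs with h
        · rw [h]
        · exact i1 b hb (by omega)
      · intro b hb
        rw [Function.update_of_ne, i2 b fun h => (Nat.le_succ a).trans (hb h)]
        rintro rfl
        exact absurd (hb haO) (by omega)
    · simpa [i15] using hno fun h => c1 (hmem.1 h).1
  · rintro τ _ ⟨-, i1, i2⟩
    exact ⟨fun a ha => i1 a ha (Finset.mem_range.1 (hOA ha)), fun a ha => i2 a fun h => absurd h ha⟩

lemma runs_mergeTables {F : ℕ} (hF : σ.reg 9 = F) :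
    Runs mergeTables σ (30 * (F + 1)) fun τ =>
      (σ.reg 14 = 0 → τ.arr 9 = σ.arr 9) ∧
      (σ.reg 14 ≠ 0 → (∀ i < F, τ.arr 9 i = σ.arr 9 i + σ.arr 10 i) ∧
        ∀ i, F ≤ i → τ.arr 9 i = σ.arr 9 i) := by
  refine Runs.ite (2 + (F + 1) * (10 + 8)) (fun c => ?_) (fun c => ?_)
    (by simp only [Expr.cost]; omega)
  · have c' : σ.reg 14 ≠ 0 := c
    refine Runs.forLoop (fun k τ => (∀ i < k, τ.arr 9 i = σ.arr 9 i + σ.arr 10 i) ∧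
        ∀ i, k ≤ i → τ.arr 9 i = σ.arr 9 i)
      rfl rfl (by decide) hF (by simp) ?_ (fun _ _ h => ⟨fun h' => absurd h' c', fun _ => h⟩)
      le_rfl
    rintro k hk τ hFr hki ⟨h1, h2⟩
    have e10 : τ.arr 10 = σ.arr 10 := hFr.arr 10 rfl
    refine Runs.of_run rfl (by decide) ?_
    simp only [Prog.run, Expr.eval, hki, e10, State.setReg_arr, State.setArr_arr, if_true,
      h2 k le_rfl, Function.update_apply]
    refine ⟨fun i hi => ?_, fun i hi => ?_⟩
    · split_ifs with h
      · rw [h]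
      · exact h1 i (by omega)
    · rw [if_neg (by omega), h2 i (by omega)]
  · have c' : σ.reg 14 = 0 := c
    exact Runs.of_run rfl (by simp only [Prog.time]; omega)
      ⟨fun _ => rfl, fun h => absurd c' h⟩

end CountCuts

/-! ### The table under the addition of a block -/

namespace CountCuts

open RAM

variable {N : Network} {r : ℕ → ℕ} {σ τ : State} {k : ℕ}

/-- Array `9` is the table of the cuts on the side of the sources of the set in array `7`. -/
structure Tabulated (N : Network) (r : ℕ → ℕ) (k : ℕ) (σ : State) : Prop where
  stores : Stores N σ
  residual : σ.arr 4 = r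
  closed : N.Closed r (side N σ)
  separates : N.Separates (side N σ)
  size : σ.reg 9 = 2 ^ k
  weights : BinaryWeights (σ.arr 8) (N.out (side N σ)) k
  table : ∀ i, σ.arr 9 i =
    table (N.cuts r (side N σ)) (σ.arr 8) (N.out (side N σ)) ∅ i

lemma Tabulated.congr (h : Tabulated N r k σ) (hτ : Stores N τ) (h4 : τ.arr 4 = σ.arr 4)
    (h7 : τ.arr 7 = σ.arr 7) (h8 : τ.arr 8 = σ.arr 8) (h9 : τ.arr 9 = σ.arr 9)
    (r9 : τ.reg 9 = σ.reg 9) : Tabulated N r k τ := by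
  have hs : side N τ = side N σ := by rw [side, h7, side]
  constructor
  · exact hτ
  · rw [h4, h.residual]
  · rw [hs]; exact h.closed
  · rw [hs]; exact h.separates
  · rw [r9, h.size]
  · rw [hs, h8]; exact h.weights
  · rw [hs, h8, h9]; exact h.table

/-- After `enterBlock`, arrays `9` and `10` hold the two summands of `table_step`; `cuts_step` and
`BinaryWeights.inherit` identify their sum as the table of the enlarged set. -/
lemma runs_addBlock (h : Tabulated N r k σ) (hr : N.Balanced r)
    (hk : ∀ W, N.Closed r W → N.Separates W → (N.out W).card = k)
    (hc : N.Closed r (marks N σ)) (hT : Disjoint (marks N σ) N.T)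
    (hblock : ∀ W, N.Closed r W → N.S ⊆ W → W ⊆ side N σ ∪ marks N σ → ¬ W ⊆ side N σ →
      (side N σ ∪ marks N σ) \ side N σ ⊆ W) :
    Runs addBlock σ (300 * (N.n + 1) * (N.A + 1) * (2 ^ k + 1)) fun τ =>
      Tabulated N r k τ ∧ side N τ = side N σ ∪ marks N σ := by
  have hUV : side N σ ⊆ side N σ ∪ marks N σ := Finset.subset_union_left
  have hVc : N.Closed r (side N σ ∪ marks N σ) := h.closed.union hc
  have hVs : N.Separates (side N σ ∪ marks N σ) :=
    ⟨h.separates.source.trans hUV, Finset.disjoint_union_left.2 ⟨h.separates.target, hT⟩⟩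
  -- Both frontiers are minimum cuts with `k` arcs, so their differences have equal size.
  have hcard : (leaving N σ).card = (entering N σ).card :=
    Finset.card_sdiff_comm (by rw [hk _ hVc hVs, hk _ h.closed h.separates])
  have hJO : Disjoint (entering N σ) (leaving N σ) := leaving_disjoint.symm.mono_left entering_subset
  have hout : N.out (side N σ) \ entering N σ ∪ leaving N σ = N.out (side N σ ∪ marks N σ) := by
    ext a
    simp only [entering, leaving, Finset.mem_union, Finset.mem_sdiff]
    tauto
  have hstep : N.cuts r (side N σ ∪ marks N σ) = N.cuts r (side N σ) ∪
      ((N.cuts r (side N σ)).filter fun X => entering N σ ⊆ X).image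
        fun X => X \ entering N σ ∪ leaving N σ :=
    Network.cuts_step hr h.closed hVc hUV h.separates.source hblock
  refine Runs.seq _ (100 * (N.A + 1) * (2 ^ k + 1) + (50 * (N.A + 1) +
    (30 * (2 ^ k + 1) + 30 * (N.n + 1)))) (runs_copyTable h.size) (fun τ₁ F₁ h₁ => ?_) ?_
  swap
  · have h1 : 1 ≤ N.n + 1 := by omega
    have h2 : 1 ≤ N.A + 1 := by omega
    have h3 : 1 ≤ 2 ^ k + 1 := Nat.le_add_left _ _
    generalize N.n + 1 = x at *
    generalize N.A + 1 = y at *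
    generalize 2 ^ k + 1 = z at *
    have e1 : y * z ≤ x * y * z := Nat.mul_le_mul_right _ (Nat.le_mul_of_pos_left _ h1)
    have e2 : x ≤ x * y * z := by
      rw [mul_assoc]; exact Nat.le_mul_of_pos_right _ (Nat.mul_pos h2 h3)
    have e3 : y ≤ y * z := Nat.le_mul_of_pos_right _ h3
    have e4 : z ≤ y * z := Nat.le_mul_of_pos_left _ h2
    rw [mul_assoc 100, mul_assoc 300, mul_assoc 300]
    omega
  have s₁ := h.stores.frame F₁ rfl
  have d₁ : side N τ₁ = side N σ := by rw [side, F₁.arr 7 rfl, side]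
  have m₁ : marks N τ₁ = marks N σ := by rw [marks, F₁.arr 5 rfl, marks]
  have j₁ : entering N τ₁ = entering N σ := by rw [entering, d₁, m₁, entering]
  have w₁ : τ₁.arr 8 = σ.arr 8 := F₁.arr 8 rfl
  have t₁ : τ₁.arr 9 = σ.arr 9 := F₁.arr 9 rfl
  refine Runs.seq _ _ (runs_enterBlock (𝒳 := N.cuts r (side N σ)) s₁
    (by rw [F₁.reg 9 rfl, h.size]) (by rw [d₁, w₁]; exact h.weights)
    (by rw [d₁, w₁, t₁]; exact h.table)
    (by rw [d₁, w₁]; intro i hi; rw [h₁ i hi, h.table])) (fun τ₂ F₂ h₂ => ?_) le_rfl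
  rw [d₁, w₁, j₁] at h₂
  obtain ⟨h9, h10, h14, h11⟩ := h₂
  have s₂ := s₁.frame F₂ rfl
  have l₂ : leaving N τ₂ = leaving N σ := by
    rw [leaving, leaving, side, marks, F₂.arr 7 rfl, F₁.arr 7 rfl, F₂.arr 5 rfl, F₁.arr 5 rfl]; rfl
  have w₂ : τ₂.arr 8 = σ.arr 8 := by rw [F₂.arr 8 rfl, w₁]
  refine Runs.seq _ _ (runs_leaveBlock (J := entering N σ) s₂ (l₂ ▸ hJO) (l₂ ▸ hcard) h11)
    (fun τ₃ F₃ h₃ => ?_) le_rfl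
  rw [l₂, w₂] at h₃
  have hw := h.weights.inherit entering_subset hcard h11 h₃.2 h₃.1
  rw [hout] at hw
  have c₃ : τ₃.reg 9 = 2 ^ k := by rw [F₃.reg 9 rfl, F₂.reg 9 rfl, F₁.reg 9 rfl, h.size]
  refine Runs.seq _ _ (runs_mergeTables c₃) (fun τ₄ F₄ h₄ => ?_) le_rfl
  rw [F₃.reg 14 rfl, h14, F₃.arr 9 rfl, F₃.arr 10 rfl] at h₄
  have s₄ := (s₂.frame F₃ rfl).frame F₄ rfl
  refine (runs_absorb s₄).mono le_rfl fun τ F h' => ?_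
  have hside : side N τ = side N σ ∪ marks N σ := by
    rw [side, h', F₄.arr 7 rfl, F₃.arr 7 rfl, F₂.arr 7 rfl, F₁.arr 7 rfl, F₄.arr 5 rfl,
      F₃.arr 5 rfl, F₂.arr 5 rfl, F₁.arr 5 rfl]
    rfl
  have w : τ.arr 8 = τ₃.arr 8 := by rw [F.arr 8 rfl, F₄.arr 8 rfl]
  refine ⟨⟨s₄.frame F rfl, ?_, ?_, ?_, ?_, ?_, ?_⟩, hside⟩
  · rw [F.arr 4 rfl, F₄.arr 4 rfl, F₃.arr 4 rfl, F₂.arr 4 rfl, F₁.arr 4 rfl, h.residual]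
  · rwa [hside]
  · rwa [hside]
  · rw [F.reg 9 rfl, F₄.reg 9 rfl, c₃]
  · rw [hside, w]; exact hw.1
  · intro i
    rw [hside, w, F.arr 9 rfl, hstep]
    -- Without entering arcs there are no leaving ones, and the block yields no new cut; adding the
    -- tables would count every cut twice.
    by_cases hJ : entering N σ = ∅
    · have hO : leaving N σ = ∅ := by rw [← Finset.card_eq_zero, hcard, hJ]; rfl
      have hw' : τ₃.arr 8 = σ.arr 8 := funext fun a => h₃.2 a (by simp [hO])
      rw [h₄.1 (by rw [hJ]; rfl), h9, ← hout, hJ, hO, hw']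
      simp
    · have hJ' := Finset.nonempty_iff_ne_empty.2 hJ
      have hO' : (leaving N σ).Nonempty := by
        rw [← Finset.card_pos, hcard, Finset.card_pos]; exact hJ'
      have key := table_step (𝒳 := N.cuts r (side N σ)) (w := σ.arr 8) entering_subset
        leaving_disjoint hO'
        (fun X hX => Network.disjoint_of_mem_cuts hUV hX) h₃.2 hw.2 i
      rw [hout] at key
      refine Eq.trans ?_ key.symm
      have h4 := h₄.2 (by rw [Finset.card_eq_zero.ne]; exact hJ)
      by_cases hi : i < 2 ^ k
      · rw [h4.1 i hi, h9, h10 i hi]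
      · rw [h4.2 i (by omega), h9, table_eq_zero h.weights (J := entering N σ) (by omega), add_zero]

/-- The initial side is the least closed set that contains the sources, so its frontier `D` is the
only cut, and the code of `D` has all `k` bits set. -/
lemma runs_initTable (hσ : Stores N σ) (hc : N.Closed (σ.arr 4) (side N σ))
    (hs : N.Separates (side N σ)) (hl : ∀ C, N.Closed (σ.arr 4) C → N.S ⊆ C → side N σ ⊆ C)
    (h9 : ∀ i, σ.arr 9 i = 0) (hk : (N.out (side N σ)).card = k) :
    Runs initTable σ (50 * (N.A + 1)) (Tabulated N (σ.arr 4) k) := by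
  set D := N.out (side N σ) with hD
  have hDA : D ⊆ Finset.range N.A := out_subset_range _
  refine Runs.run_seq ((2 + (N.A + 1) * (20 + 8)) + 5) rfl ?_
    (by simp only [Prog.time, Expr.cost]; omega)
  have hσ' := hσ.run (P := .set 9 (.const 1)) rfl rfl
  refine Runs.seq _ 5 (Q' := fun τ => τ.reg 9 = 2 ^ k ∧ ∀ a ∈ D, τ.arr 8 a = 2 ^ rank D a)
    (Runs.forLoop (c := 20) (fun a τ => τ.reg 9 = 2 ^ rank D a ∧
      ∀ b ∈ D, b < a → τ.arr 8 b = 2 ^ rank D b) rfl rfl (by decide) hσ'.A ?_ ?_ ?_ le_rfl)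
    (fun τ F h => ?_) le_rfl
  · simp [Prog.run, Expr.eval, rank_zero]
  · rintro a ha τ hFr hai ⟨i9, i8⟩
    have hτ := hσ'.frame hFr rfl
    have e7 : τ.arr 7 = σ.arr 7 := hFr.arr 7 rfl
    have hmem : a ∈ D ↔ σ.arr 7 (N.tl a) ≠ 0 ∧ σ.arr 7 (N.hd a) = 0 := by
      simp [hD, Network.mem_out, side, mem_support, ha, N.tl_lt a ha, N.hd_lt ha]
    have hno : a ∉ D → 2 ^ rank D a = 2 ^ rank D (a + 1) ∧
        ∀ b ∈ D, b < a + 1 → τ.arr 8 b = 2 ^ rank D b := by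
      intro haD
      rw [rank_succ_of_notMem haD]
      refine ⟨rfl, fun b hb hba => i8 b hb ?_⟩
      rcases Nat.lt_succ_iff_lt_or_eq.1 hba with h | rfl
      · exact h
      · exact absurd hb haD
    refine Runs.of_run rfl (by decide) ?_
    simp only [Prog.run, Expr.eval, hai, hτ.tl a ha, hτ.hd a ha, e7]
    split_ifs with c1 c2
    · simpa [i9] using hno fun h => c2 (hmem.1 h).2
    · rw [not_not] at c2
      have haD := hmem.2 ⟨c1, c2⟩
      simp only [State.setReg_reg, State.setReg_arr, State.setArr_reg, State.setArr_arr, i9,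
        rank_succ_of_mem haD, if_true, if_false, Nat.reduceEqDiff]
      refine ⟨by rw [pow_succ]; ring, fun b hb hba => ?_⟩
      rcases Nat.lt_succ_iff_lt_or_eq.1 hba with h | rfl
      · rw [Function.update_of_ne h.ne, i8 b hb h]
      · rw [Function.update_self]
    · simpa [i9] using hno fun h => c1 (hmem.1 h).1
  · rintro τ _ ⟨i9, i8⟩
    exact ⟨by rw [i9, rank_eq_card hDA, hk], fun a ha => i8 a ha (Finset.mem_range.1 (hDA ha))⟩
  · refine Runs.of_run rfl (by simp only [Prog.time, Expr.cost]; omega) ?_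
    have hτ := (hσ'.frame F rfl).run
      (P := .store 9 (.sub (.reg 9) (.const 1)) (.const 1)) rfl rfl
    have e7 : τ.arr 7 = σ.arr 7 := F.arr 7 rfl
    have e4 : τ.arr 4 = σ.arr 4 := F.arr 4 rfl
    have e9 : τ.arr 9 = σ.arr 9 := F.arr 9 rfl
    have hside : side N ((Prog.store 9 (.sub (.reg 9) (.const 1)) (.const 1)).run τ) =
        side N σ := by
      simp [side, Prog.run, e7]
    have hw : BinaryWeights (τ.arr 8) D k :=
      ⟨rank D, fun a ha => ⟨h.2 a ha, hk ▸ rank_lt_card ha⟩, rank_injOn D⟩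
    have hcuts : N.cuts (σ.arr 4) (side N σ) = {D} := by
      ext X
      rw [Network.mem_cuts, Finset.mem_singleton]
      constructor
      · rintro ⟨W, hWU, hSW, hW, rfl⟩
        rw [hWU.antisymm (hl W hW hSW)]
      · rintro rfl
        exact ⟨_, subset_rfl, hs.source, hc, rfl⟩
    have hcode : code (τ.arr 8) D D = 2 ^ k - 1 := by
      rw [code, Finset.inter_self, Finset.sum_congr rfl h.2, sum_two_pow_rank, hk]
    constructor
    · exact hτ
    · simp [Prog.run, e4]
    · rw [hside]; exact hc
    · rw [hside]; exact hs
    · simp [Prog.run, h.1]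
    · rw [hside]; simpa [Prog.run] using hw
    · intro i
      rw [hside, hcuts, ← hD]
      simp only [Prog.run, Expr.eval, State.setArr_arr, if_true, h.1, Nat.reduceEqDiff, if_false,
        Function.update_apply, e9, h9, _root_.table, Finset.filter_singleton, hcode,
        Finset.empty_subset, true_and]
      by_cases hi : i = 2 ^ k - 1
      · simp [hi]
      · simp [hi, Ne.symm hi]

/-! ## The order of the blocks -/

open Classical in
/-- The vertices that are reachable by residual arcs from the sources and the vertex `x`. -/
noncomputable def reach (N : Network) (r : ℕ → ℕ) (x : ℕ) : Finset ℕ :=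
  (Finset.range N.n).filter fun v => ∀ C, N.Closed r C → insert x N.S ⊆ C → v ∈ C

lemma reach_eq {x : ℕ} {R : Finset ℕ} (hR : R ⊆ Finset.range N.n) (hc : N.Closed r R)
    (hx : insert x N.S ⊆ R) (hl : ∀ C, N.Closed r C → insert x N.S ⊆ C → R ⊆ C) :
    reach N r x = R := by
  classical
  ext v
  simp only [reach, Finset.mem_filter]
  exact ⟨fun h => h.2 R hc hx, fun h => ⟨hR h, fun C hC hxC => hl C hC hxC h⟩⟩

lemma reach_subset {x : ℕ} {C : Finset ℕ} (hC : N.Closed r C) (hx : insert x N.S ⊆ C) :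
    reach N r x ⊆ C := by
  classical
  intro v hv
  exact (Finset.mem_filter.1 hv).2 C hC hx

lemma insert_subset_reach {x : ℕ} (hx : x < N.n) : insert x N.S ⊆ reach N r x := by
  classical
  intro v hv
  refine Finset.mem_filter.2 ⟨?_, fun C _ hC => hC hv⟩
  rcases Finset.mem_insert.1 hv with rfl | h
  · exact Finset.mem_range.2 hx
  · exact N.S_sub h

/-- The set in array `7` contains the vertices that reach no target and fewer than `c` vertices, or
`c` vertices if they are smaller than `v`. -/
def Covers (N : Network) (r : ℕ → ℕ) (c v : ℕ) (σ : State) : Prop :=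
  ∀ x < N.n, Disjoint (reach N r x) N.T →
    ((reach N r x).card < c ∨ ((reach N r x).card = c ∧ x < v)) → x ∈ side N σ

/-- For `x` in `reach N r v` outside the current side, `reach N r x` is contained in `reach N r v`
and avoids the targets. If it were smaller, `x` would have been covered before. So the two sets
coincide, which makes the block indivisible. -/
lemma runs_tryVertex {c v : ℕ} (h : Tabulated N r k σ) (hr : N.Balanced r)
    (hk : ∀ W, N.Closed r W → N.Separates W → (N.out W).card = k)
    (hc : Covers N r c v σ) (h10 : σ.reg 10 = c) (h11 : σ.reg 11 = v) (hv : v < N.n) :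
    Runs tryVertex σ (500 * (N.n + 1) * (N.A + 1) * (2 ^ k + 1)) fun τ =>
      Tabulated N r k τ ∧ Covers N r c (v + 1) τ := by
  have hkeep : ∀ τ, Tabulated N r k τ → side N τ = side N σ →
      (Disjoint (reach N r v) N.T → (reach N r v).card = c → v ∈ side N σ) →
      Tabulated N r k τ ∧ Covers N r c (v + 1) τ := by
    refine fun τ hτ hs hno => ⟨hτ, fun x hx hxT hxc => ?_⟩
    rw [hs]
    by_cases hxv : x = v
    · subst hxv
      rcases hxc with h1 | h1
      · exact hc x hx hxT (Or.inl h1)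
      · exact hno hxT h1.1
    · exact hc x hx hxT (hxc.imp id fun h1 => ⟨h1.1, by omega⟩)
  refine Runs.ite (490 * (N.n + 1) * (N.A + 1) * (2 ^ k + 1)) (fun c1 => ?_) (fun c1 => ?_) ?_
  · have c1' : σ.arr 7 v ≠ 0 := h11 ▸ c1
    refine Runs.of_run rfl (Nat.mul_pos (Nat.mul_pos (Nat.mul_pos (by omega) (Nat.succ_pos _))
      (Nat.succ_pos _)) (Nat.succ_pos _)) (hkeep σ h rfl fun _ _ => mem_support.2 ⟨hv, c1'⟩)
  swap
  · have : 1 ≤ (N.n + 1) * (N.A + 1) * (2 ^ k + 1) :=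
      Nat.mul_pos (Nat.mul_pos (Nat.succ_pos _) (Nat.succ_pos _)) (Nat.succ_pos _)
    simp only [Expr.cost, mul_assoc] at this ⊢
    omega
  have hvU : v ∉ side N σ := by
    have c1' : σ.arr 7 v = 0 := h11 ▸ c1
    simp [side, mem_support, c1']
  refine Runs.seq _ (3 + (100 * (N.n + 1) * (N.A + 1) + (40 * (N.n + 1) + (10 +
    300 * (N.n + 1) * (N.A + 1) * (2 ^ k + 1))))) (runs_initMark h.stores) (fun τ₁ F₁ h₁ => ?_) ?_
  swap
  · have h1 : 1 ≤ N.n + 1 := by omega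
    have h2 : 1 ≤ N.A + 1 := by omega
    have h3 : 1 ≤ 2 ^ k + 1 := Nat.le_add_left _ _
    generalize N.n + 1 = x at *
    generalize N.A + 1 = y at *
    generalize 2 ^ k + 1 = z at *
    have e1 : x * y ≤ x * y * z := Nat.le_mul_of_pos_right _ h3
    have e2 : x ≤ x * y := Nat.le_mul_of_pos_right _ h2
    rw [mul_assoc 100, mul_assoc 300, mul_assoc 300, mul_assoc 490, mul_assoc 490]
    omega
  have s₁ := h.stores.frame F₁ rfl
  refine Runs.run_seq _ rfl ?_ (by simp only [Prog.time, Expr.cost]; exact le_rfl)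
  set τ₂ := (Prog.store 5 (.reg 11) (.const 1)).run τ₁ with hτ₂
  have s₂ : Stores N τ₂ := s₁.run rfl rfl
  have hM : insert v N.S ⊆ Finset.range N.n :=
    Finset.insert_subset (Finset.mem_range.2 hv) N.S_sub
  have r11 : τ₁.reg 11 = v := by rw [F₁.reg 11 rfl, h11]
  refine Runs.seq _ _ (runs_search s₂ hM ?_) (fun τ₃ F₃ h₃ => ?_) le_rfl
  · intro u hu
    simp only [hτ₂, Prog.run, Expr.eval, State.setArr_arr, if_true, r11, Function.update_apply,
      Finset.mem_insert]
    by_cases huv : u = v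
    · simp [huv]
    · simp [huv, h₁ u hu]
  have e4 : τ₂.arr 4 = r := by
    simp only [hτ₂, Prog.run, State.setArr_arr, Nat.reduceEqDiff, if_false]
    rw [F₁.arr 4 rfl, h.residual]
  rw [e4] at h₃
  have s₃ := s₂.frame F₃ rfl
  have hreach : reach N r v = marks N τ₃ :=
    reach_eq (Finset.filter_subset _ _) h₃.2 (h₃.1.start_subset hM) h₃.1.sound
  refine Runs.seq _ _ (runs_countMarked s₃) (fun τ₄ F₄ h₄ => ?_) le_rfl
  have s₄ := s₃.frame F₄ rfl
  have hmarks : marks N τ₄ = reach N r v := by rw [hreach, marks, F₄.arr 5 rfl, marks]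
  have hc4 : τ₄.reg 12 = (reach N r v).card := by rw [h₄.1, hreach]; rfl
  have hT4 : τ₄.reg 13 = 0 ↔ Disjoint (reach N r v) N.T := by rw [h₄.2, hreach]; rfl
  have h10' : τ₄.reg 10 = c := by
    rw [F₄.reg 10 rfl, F₃.reg 10 rfl, ← h10, ← F₁.reg 10 rfl]
    rfl
  have e7 : τ₄.arr 7 = σ.arr 7 := by
    rw [F₄.arr 7 rfl, F₃.arr 7 rfl, ← F₁.arr 7 rfl]
    simp [hτ₂, Prog.run]
  have hside : side N τ₄ = side N σ := by rw [side, e7, side]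
  have ht : Tabulated N r k τ₄ := by
    refine h.congr s₄ ?_ e7 ?_ ?_ ?_
    · rw [F₄.arr 4 rfl, F₃.arr 4 rfl, e4, h.residual]
    · rw [F₄.arr 8 rfl, F₃.arr 8 rfl, ← F₁.arr 8 rfl]; simp [hτ₂, Prog.run]
    · rw [F₄.arr 9 rfl, F₃.arr 9 rfl, ← F₁.arr 9 rfl]; simp [hτ₂, Prog.run]
    · rw [F₄.reg 9 rfl, F₃.reg 9 rfl, ← F₁.reg 9 rfl]; simp [hτ₂, Prog.run]
  refine Runs.ite (300 * (N.n + 1) * (N.A + 1) * (2 ^ k + 1)) (fun c2 => ?_) (fun c2 => ?_)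
    (by simp only [Expr.cost]; omega)
  · refine Runs.of_run rfl (Nat.mul_pos (Nat.mul_pos (Nat.mul_pos (by omega) (Nat.succ_pos _))
      (Nat.succ_pos _)) (Nat.succ_pos _)) (hkeep τ₄ ht hside fun hT hcc => ?_)
    simp only [Expr.eval, hT4.2 hT, hc4, hcc, h10'] at c2
    omega
  -- Both truncated differences vanish only if the number of marked vertices is `c`.
  · simp only [Expr.eval, hc4, h10', Nat.add_eq_zero_iff] at c2
    have hT := hT4.1 c2.1
    have hcc : (reach N r v).card = c := by omega
    refine (runs_addBlock ht hr hk ?_ ?_ ?_).mono le_rfl ?_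
    · rw [hmarks, hreach]; exact h₃.2
    · rwa [hmarks]
    · rw [hside, hmarks]
      intro W hW hSW hWV hWU
      obtain ⟨x, hxW, hxU⟩ := Finset.not_subset.1 hWU
      have hxR : x ∈ reach N r v := (Finset.mem_union.1 (hWV hxW)).resolve_left hxU
      have hRc : N.Closed r (reach N r v) := hreach ▸ h₃.2
      have hSR : N.S ⊆ reach N r v :=
        (Finset.subset_insert _ _).trans (insert_subset_reach hv)
      have hxn : x < N.n := by
        rw [hreach] at hxR
        exact (mem_support.1 hxR).1
      have h1 : reach N r x ⊆ reach N r v := reach_subset hRc (Finset.insert_subset hxR hSR)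
      have h2 : reach N r x ⊆ W := reach_subset hW (Finset.insert_subset hxW hSW)
      have h3 : ¬ (reach N r x).card < c := fun hlt =>
        hxU (hc x hxn (hT.mono_left h1) (Or.inl hlt))
      have h4 : reach N r x = reach N r v := Finset.eq_of_subset_of_card_le h1 (by omega)
      rw [← h4]
      intro y hy
      simp only [Finset.mem_sdiff, Finset.mem_union] at hy
      exact h2 (hy.1.resolve_left hy.2)
    · rintro τ _ ⟨hτ, hs⟩
      refine ⟨hτ, fun x hx hxT hxc => ?_⟩
      rw [hs, hside, hmarks, Finset.mem_union]
      by_cases hxv : x = v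
      · subst hxv
        exact Or.inr (insert_subset_reach hv (Finset.mem_insert_self _ _))
      · exact Or.inl (hc x hx hxT (hxc.imp id fun h1 => ⟨h1.1, by omega⟩))

end CountCuts

/-! ### All blocks, input and output -/

namespace CountCuts

open RAM

variable {N : Network} {r : ℕ → ℕ} {σ τ : State} {k : ℕ}

lemma runs_addBlocks (h : Tabulated N r k σ) (hr : N.Balanced r)
    (hk : ∀ W, N.Closed r W → N.Separates W → (N.out W).card = k) :
    Runs addBlocks σ (2000 * (N.n + 1) ^ 3 * (N.A + 1) * (2 ^ k + 1)) fun τ =>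
      Tabulated N r k τ ∧ ∀ x < N.n, Disjoint (reach N r x) N.T → x ∈ side N τ := by
  set X := 500 * (N.n + 1) * (N.A + 1) * (2 ^ k + 1) with hX
  have hX1 : 500 ≤ X := by
    have : 1 ≤ (N.n + 1) * (N.A + 1) * (2 ^ k + 1) :=
      Nat.mul_pos (Nat.mul_pos (Nat.succ_pos _) (Nat.succ_pos _)) (Nat.succ_pos _)
    simp only [mul_assoc] at this hX
    omega
  refine Runs.run_seq (2 + (N.n + 2) * ((2 + (N.n + 1) * (X + 8)) + 8)) rfl ?_ ?_
  swap
  · simp only [Prog.time, Expr.cost]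
    have e : 2000 * (N.n + 1) ^ 3 * (N.A + 1) * (2 ^ k + 1) = 4 * (N.n + 1) ^ 2 * X := by
      rw [hX]; ring
    rw [e]
    nlinarith [Nat.zero_le (N.n * X), Nat.zero_le (N.n ^ 2 * X), Nat.zero_le N.n,
      Nat.mul_le_mul_left N.n hX1, Nat.mul_le_mul_left (N.n ^ 2) hX1]
  have h' : Tabulated N r k ((Prog.set 20 (.add (.reg 0) (.const 1))).run σ) :=
    h.congr (h.stores.run rfl rfl) rfl rfl rfl rfl rfl
  refine Runs.forLoop (N := N.n + 1) (fun c τ => Tabulated N r k τ ∧ Covers N r c 0 τ)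
    rfl rfl (by decide) (by simp [Prog.run, Expr.eval, h.stores.n]) ?_ ?_ ?_ le_rfl
  · refine ⟨h'.congr (h'.stores.frame (exec_run (P := .set 10 (.const 0)) rfl _).choose_spec.2.frame
      rfl) rfl rfl rfl rfl rfl, fun x _ _ hx => by omega⟩
  · rintro c hc τ hF hτc ⟨hτ, hcov⟩
    have hsetReg : ∀ (τ : State) (i v : ℕ), i = 10 ∨ i = 11 → Tabulated N r k τ →
        Tabulated N r k (τ.setReg i v) := by
      intro τ i v hi hτ
      refine hτ.congr (hτ.stores.frame (P := .set i (.const v))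
        (exec_run (P := .set i (.const v)) rfl _).choose_spec.2.frame ?_) rfl rfl rfl rfl ?_
      · rcases hi with rfl | rfl <;> rfl
      · rcases hi with rfl | rfl <;> rfl
    refine Runs.forLoop (N := N.n) (fun v τ => Tabulated N r k τ ∧ Covers N r c v τ)
      rfl rfl (by decide) hτ.stores.n ?_ ?_ ?_ le_rfl
    · exact ⟨hsetReg _ _ _ (Or.inr rfl) hτ, hcov⟩
    · rintro v hv τ' hF' hv' ⟨hτ', hcov'⟩
      refine (runs_tryVertex hτ' hr hk hcov' ?_ hv' hv).mono le_rfl ?_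
      · rw [hF'.reg 10 rfl, hτc]
      · exact fun τ'' _ h'' => ⟨hsetReg _ _ _ (Or.inr rfl) h''.1, h''.2⟩
    · rintro τ' _ ⟨hτ', hcov'⟩
      refine ⟨hsetReg _ _ _ (Or.inl rfl) hτ', fun x hx hxT hxc => hcov' x hx hxT ?_⟩
      omega
  · classical
    rintro τ _ ⟨hτ, hcov⟩
    -- The outer loop ends at `N.n + 1`, which exceeds the size of every set `reach N r x`.
    refine ⟨hτ, fun x hx hxT => hcov x hx hxT (Or.inl ?_)⟩
    have : (reach N r x).card ≤ N.n :=
      (Finset.card_filter_le _ _).trans (Finset.card_range _).le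
    omega

lemma runs_sumTable (h : σ.reg 9 = 2 ^ k) :
    Runs sumTable σ (30 * (2 ^ k + 1)) fun τ =>
      τ.reg 0 = ∑ i ∈ Finset.range (2 ^ k), σ.arr 9 i := by
  refine Runs.run_seq ((2 + (2 ^ k + 1) * (10 + 8)) + 2) rfl ?_
    (by simp only [Prog.time, Expr.cost]; omega)
  refine Runs.seq _ 2 (Q' := fun τ => τ.reg 19 = ∑ i ∈ Finset.range (2 ^ k), σ.arr 9 i)
    (Runs.forLoop (c := 10) (N := 2 ^ k)
      (fun j τ => τ.reg 19 = ∑ i ∈ Finset.range j, σ.arr 9 i) rfl rfl (by decide)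
      (by simpa [Prog.run] using h) (by simp [Prog.run, Expr.eval]) ?_ (fun _ _ h => h) le_rfl)
    (fun τ _ h => Runs.of_run rfl le_rfl (by simpa [Prog.run, Expr.eval] using h)) le_rfl
  intro j _ τ hF hj hI
  have e9 : τ.arr 9 = σ.arr 9 := hF.arr 9 rfl
  refine Runs.of_run rfl (by decide) ?_
  simp [Prog.run, Expr.eval, hj, hI, e9, Finset.sum_range_succ]

lemma runs_makeArcs (I : CutInstance) :
    Runs makeArcs I.input (70 * (I.m + 1)) fun τ =>
      Stores I.network τ ∧ ∀ a < I.network.A, τ.arr 4 a = 1 := by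
  have hfst : ∀ j, I.input.arr 0 j = I.endpt I.fst j := fun j => rfl
  have hsnd : ∀ j, I.input.arr 1 j = I.endpt I.snd j := fun j => rfl
  refine Runs.run_seq (2 + (I.m + 1) * (40 + 8)) rfl ?_
    (by simp only [Prog.time, Expr.cost]; omega)
  set σ₁ := (Prog.set 2 (.add (.reg 1) (.reg 1))).run I.input with hσ₁
  have a₁ : σ₁.arr = I.input.arr := rfl
  have r₁ : σ₁.reg 1 = I.m := rfl
  refine Runs.forLoop (N := I.m) (fun k τ =>
      (∀ j, τ.arr 0 j = if I.m ≤ j ∧ j < I.m + k then I.endpt I.snd (j - I.m)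
        else I.endpt I.fst j) ∧
      (∀ j, τ.arr 1 j = if I.m ≤ j ∧ j < I.m + k then I.endpt I.fst (j - I.m)
        else I.endpt I.snd j) ∧
      (∀ j < k, τ.arr 12 j = j + I.m ∧ τ.arr 12 (j + I.m) = j) ∧
      (∀ j < k, τ.arr 4 j = 1 ∧ τ.arr 4 (j + I.m) = 1))
    rfl rfl (by decide) r₁ ?_ ?_ ?_ le_rfl
  · refine ⟨fun j => ?_, fun j => ?_, by simp, by simp⟩
    · rw [if_neg (by omega)]; rfl
    · rw [if_neg (by omega)]; rfl
  · rintro k hk τ hF hki ⟨i0, i1, i12, i4⟩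
    have rm : τ.reg 1 = I.m := by rw [hF.reg 1 rfl, r₁]
    refine Runs.of_run rfl (by decide) ?_
    have k0 : τ.arr 0 k = I.endpt I.fst k := by rw [i0, if_neg (by omega)]
    have k1 : τ.arr 1 k = I.endpt I.snd k := by rw [i1, if_neg (by omega)]
    simp only [Prog.run, Expr.eval, State.setReg_arr, State.setArr_reg, State.setArr_arr, hki, rm,
      Nat.reduceEqDiff, if_true, if_false, OfNat.ofNat_ne_zero, OfNat.zero_ne_ofNat, one_ne_zero,
      zero_ne_one, Function.update_apply]
    refine ⟨fun j => ?_, fun j => ?_, fun j hj => ?_, fun j hj => ?_⟩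
    · by_cases hjk : j = k + I.m
      · subst hjk
        rw [if_pos rfl, k1, if_pos (by omega), Nat.add_sub_cancel]
      · rw [if_neg hjk, i0]
        congr 1
        simp only [eq_iff_iff]
        omega
    · by_cases hjk : j = k + I.m
      · subst hjk
        rw [if_pos rfl, if_neg (by omega), k0, if_pos (by omega), Nat.add_sub_cancel]
      · rw [if_neg hjk, i1]
        congr 1
        simp only [eq_iff_iff]
        omega
    · rcases Nat.lt_succ_iff_lt_or_eq.1 hj with hj | rfl
      · have := i12 j hj
        rw [if_neg (by omega), if_neg (by omega), if_neg (by omega), if_neg (by omega)]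
        exact this
      · rw [if_neg (by omega), if_pos rfl, if_pos rfl]
        exact ⟨rfl, rfl⟩
    · rcases Nat.lt_succ_iff_lt_or_eq.1 hj with hj | rfl
      · have := i4 j hj
        rw [if_neg (by omega), if_neg (by omega), if_neg (by omega), if_neg (by omega)]
        exact this
      · simp
  · rintro τ hF ⟨i0, i1, i12, i4⟩
    have hA : I.network.A = I.m + I.m := rfl
    refine ⟨⟨?_, ?_, ?_, ?_, ?_, ?_, ?_⟩, ?_⟩
    · rw [hF.reg 0 rfl]; rfl
    · rw [hF.reg 2 rfl]; rfl
    · intro a ha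
      rw [i0]
      simp only [CutInstance.network]
      split_ifs <;> first | rfl | omega
    · intro a ha
      rw [i1]
      simp only [CutInstance.network]
      split_ifs <;> first | rfl | omega
    · intro a ha
      simp only [CutInstance.network]
      split_ifs with h
      · exact (i12 a h).1
      · have := (i12 (a - I.m) (by omega)).2
        rwa [Nat.sub_add_cancel (by omega)] at this
    · intro v hv
      have hv' : v < I.n := hv
      rw [hF.arr 2 rfl]
      simp only [hσ₁, Prog.run, State.setReg_arr, CutInstance.input, CutInstance.network]
      simp [hv']
      congr 1
      simp only [eq_iff_iff]
      constructor
      · exact fun h => ⟨_, h, rfl⟩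
      · rintro ⟨x, hx, rfl⟩; exact hx
    · intro v hv
      have hv' : v < I.n := hv
      rw [hF.arr 3 rfl]
      simp only [hσ₁, Prog.run, State.setReg_arr, CutInstance.input, CutInstance.network]
      simp [hv']
      constructor
      · exact fun h => ⟨_, h, rfl⟩
      · rintro ⟨x, hx, rfl⟩; exact hx
    · intro a ha
      by_cases h : a < I.m
      · exact (i4 a h).1
      · have := (i4 (a - I.m) (by omega)).2
        rwa [Nat.sub_add_cancel (by omega)] at this

end CountCuts

/-! ### Correctness and total number of steps -/

namespace CountCuts

open RAM

lemma runs_main (I : CutInstance) :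
    Runs main I.input (70 * (I.m + 1) + (250 * (I.minCutSize + 2) * (I.n + 1) * (I.m + I.m + 1) +
      (30 * (I.n + 1) + (50 * (I.m + I.m + 1) + (2000 * (I.n + 1) ^ 3 * (I.m + I.m + 1) *
        (2 ^ I.minCutSize + 1) + 30 * (2 ^ I.minCutSize + 1))))))
      fun τ => τ.reg 0 = I.numMinCuts := by
  refine Runs.seq _ _ (runs_makeArcs I) (fun τ₁ F₁ ⟨s₁, h₁⟩ => ?_) le_rfl
  refine Runs.seq _ _ (runs_maxFlow s₁ h₁ fun r hr => CutInstance.val_le_minCutSize hr)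
    (fun τ₂ F₂ h₂ => ?_) le_rfl
  have s₂ := s₁.frame F₂ rfl
  refine Runs.seq _ _ (runs_absorb s₂) (fun τ₃ F₃ h₃ => ?_) le_rfl
  have s₃ := s₂.frame F₃ rfl
  have z : ∀ a, 12 < a ∨ (4 < a ∧ a < 12) → ∀ i, I.input.arr a i = 0 := by
    intro a ha i
    simp only [CutInstance.input]
    rw [if_neg (by omega), if_neg (by omega), if_neg (by omega), if_neg (by omega)]
  have hside : side I.network τ₃ = support I.network.n (τ₂.arr 5) := by
    rw [side, h₃, F₂.arr 7 rfl, F₁.arr 7 rfl]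
    ext v
    simp [mem_support, z 7 (by omega)]
  have e4 : τ₃.arr 4 = τ₂.arr 4 := F₃.arr 4 rfl
  have hk : ∀ W, I.network.Closed (τ₃.arr 4) W → I.network.Separates W →
      (I.network.out W).card = I.minCutSize := fun W hW hW' =>
    CutInstance.card_out_eq (r := τ₃.arr 4) (e4 ▸ h₂.flow) hW' hW
  have hc : I.network.Closed (τ₃.arr 4) (side I.network τ₃) := by rw [e4, hside]; exact h₂.closed
  have hs : I.network.Separates (side I.network τ₃) := by rw [hside]; exact h₂.separates
  refine Runs.seq _ _ (runs_initTable s₃ hc hs (by rw [e4, hside]; exact h₂.least) ?_ (hk _ hc hs))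
    (fun τ₄ F₄ h₄ => ?_) le_rfl
  · intro i
    rw [F₃.arr 9 rfl, F₂.arr 9 rfl, F₁.arr 9 rfl]
    exact z 9 (by omega) i
  have hflow : I.network.IsFlow (τ₃.arr 4) := e4 ▸ h₂.flow
  refine Runs.seq _ _ (runs_addBlocks h₄ hflow.balanced hk) (fun τ₅ F₅ ⟨h₅, hcov⟩ => ?_) le_rfl
  refine (runs_sumTable h₅.size).mono le_rfl fun τ _ h => ?_
  rw [h, Finset.sum_congr rfl fun i _ => h₅.table i, sum_table h₅.weights,
    CutInstance.numMinCuts_eq hflow h₅.separates (Finset.filter_subset _ _) h₅.closed]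
  -- A closed separating set contains `reach N r x` for each of its vertices `x`, so none of these
  -- reaches a target and all have been added: the final side is the largest such set.
  intro W hWn hW hWc x hx
  exact hcov x (Finset.mem_range.1 (hWn hx))
    (hW.target.mono_left (reach_subset hWc (Finset.insert_subset hx hW.source)))

/-- The exponential factor of the program is only `2 ^ p`, at most `2 ^ (p * (p + 2))`. The six
terms need the constants `140`, `4500`, `60`, `150`, `96000` and `60`, whose sum is below `102000`.
-/
lemma cost_le (n m p : ℕ) :
    70 * (m + 1) + (250 * (p + 2) * (n + 1) * (m + m + 1) + (30 * (n + 1) + (50 * (m + m + 1) +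
      (2000 * (n + 1) ^ 3 * (m + m + 1) * (2 ^ p + 1) + 30 * (2 ^ p + 1))))) ≤
    102000 * (2 ^ (p * (p + 2)) * max p 1 * max m 1 * max n 1 ^ 3) := by
  have hE : 2 ^ p + 1 ≤ 2 * 2 ^ (p * (p + 2)) := by
    have h1 : 2 ^ p ≤ 2 ^ (p * (p + 2)) := Nat.pow_le_pow_right two_pos (by nlinarith)
    have h2 := Nat.one_le_two_pow (n := p * (p + 2))
    omega
  have hE1 : 1 ≤ 2 ^ (p * (p + 2)) := Nat.one_le_two_pow
  have hP : p + 2 ≤ 3 * max p 1 := by omega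
  have hP1 : 1 ≤ max p 1 := le_max_right _ _
  have hM : m + 1 ≤ 2 * max m 1 := by omega
  have hA : m + m + 1 ≤ 3 * max m 1 := by omega
  have hM1 : 1 ≤ max m 1 := le_max_right _ _
  have hn : n + 1 ≤ 2 * max n 1 := by omega
  have hn1 : 1 ≤ max n 1 := le_max_right _ _
  generalize 2 ^ (p * (p + 2)) = E at *
  generalize max p 1 = P at *
  generalize max m 1 = M at *
  generalize max n 1 = V at *
  have hV : V ≤ V ^ 3 := Nat.le_self_pow (by norm_num) V
  have hV1 : 1 ≤ V ^ 3 := Nat.one_le_pow _ _ hn1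
  have t1 : 70 * (m + 1) ≤ 140 * (E * P * M * V ^ 3) := by
    calc 70 * (m + 1) ≤ 70 * (2 * M) := by gcongr
      _ = 140 * (1 * 1 * M * 1) := by ring
      _ ≤ _ := by gcongr
  have t2 : 250 * (p + 2) * (n + 1) * (m + m + 1) ≤ 4500 * (E * P * M * V ^ 3) := by
    calc 250 * (p + 2) * (n + 1) * (m + m + 1) ≤ 250 * (3 * P) * (2 * V) * (3 * M) := by gcongr
      _ = 4500 * (1 * P * M * V) := by ring
      _ ≤ _ := by gcongr
  have t3 : 30 * (n + 1) ≤ 60 * (E * P * M * V ^ 3) := by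
    calc 30 * (n + 1) ≤ 30 * (2 * V) := by gcongr
      _ = 60 * (1 * 1 * 1 * V) := by ring
      _ ≤ _ := by gcongr
  have t4 : 50 * (m + m + 1) ≤ 150 * (E * P * M * V ^ 3) := by
    calc 50 * (m + m + 1) ≤ 50 * (3 * M) := by gcongr
      _ = 150 * (1 * 1 * M * 1) := by ring
      _ ≤ _ := by gcongr
  have t5 : 2000 * (n + 1) ^ 3 * (m + m + 1) * (2 ^ p + 1) ≤ 96000 * (E * P * M * V ^ 3) := by
    calc 2000 * (n + 1) ^ 3 * (m + m + 1) * (2 ^ p + 1)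
        ≤ 2000 * (2 * V) ^ 3 * (3 * M) * (2 * E) := by gcongr
      _ = 96000 * (E * 1 * M * V ^ 3) := by ring
      _ ≤ _ := by gcongr
  have t6 : 30 * (2 ^ p + 1) ≤ 60 * (E * P * M * V ^ 3) := by
    calc 30 * (2 ^ p + 1) ≤ 30 * (2 * E) := by gcongr
      _ = 60 * (E * 1 * 1 * 1) := by ring
      _ ≤ _ := by gcongr
  omega

lemma outputs_main (I : CutInstance) :
    Outputs main I.input I.numMinCuts
      (102000 * (2 ^ (I.minCutSize * (I.minCutSize + 2)) * max I.minCutSize 1 * max I.m 1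
        * max I.n 1 ^ 3)) := by
  obtain ⟨t, τ, h1, h2, h3⟩ := runs_main I
  exact ⟨t, τ, h1, h2.trans (cost_le _ _ _), h3⟩

lemma computable_bound :
    Computable fun p : ℕ => 102000 * (2 ^ (p * (p + 2)) * max p 1) := by
  have hpow : Primrec₂ ((· ^ ·) : ℕ → ℕ → ℕ) :=
    Primrec₂.unpaired'.1 Nat.Primrec.pow
  have hexp : Primrec fun p : ℕ => p * (p + 2) :=
    Primrec.nat_mul.comp Primrec.id (Primrec.nat_add.comp Primrec.id (Primrec.const 2))
  have hmax : Primrec fun p : ℕ => max p 1 := Primrec.nat_max.comp Primrec.id (Primrec.const 1)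
  exact (Primrec.nat_mul.comp (Primrec.const 102000)
    (Primrec.nat_mul.comp (hpow.comp (Primrec.const 2) hexp) hmax)).to_comp

end CountCuts

theorem theorem1 :
    (∃ (P : RAM.Prog) (C : ℕ), ∀ I : CutInstance,
      RAM.Outputs P I.input I.numMinCuts
        (C * (2 ^ (I.minCutSize * (I.minCutSize + 2)) * max I.minCutSize 1 * max I.m 1
          * max I.n 1 ^ 3))) ∧
    IsFPT CutInstance.input CutInstance.numMinCuts (fun I => I.n + I.m)
      CutInstance.minCutSize := by
  -- The function of the parameter takes the factors in `p`; the rest, of order `m * n ^ 3`, is at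
  -- most `(n + m + 1) ^ 4`, where the `1` covers `m = 0` and `n = 0`.
  refine ⟨⟨CountCuts.main, 102000, CountCuts.outputs_main⟩, CountCuts.main, _,
    (Polynomial.X + 1) ^ 4, CountCuts.computable_bound, fun I => ?_⟩
  obtain ⟨t, τ, h1, h2, h3⟩ := CountCuts.outputs_main I
  refine ⟨t, τ, h1, h2.trans ?_, h3⟩
  have hm : max I.m 1 ≤ I.n + I.m + 1 := by omega
  have hn : max I.n 1 ≤ I.n + I.m + 1 := by omega
  simp only [Polynomial.eval_pow, Polynomial.eval_add, Polynomial.eval_X, Polynomial.eval_one]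
  calc 102000 * (2 ^ (I.minCutSize * (I.minCutSize + 2)) * max I.minCutSize 1 * max I.m 1
        * max I.n 1 ^ 3)
      = 102000 * (2 ^ (I.minCutSize * (I.minCutSize + 2)) * max I.minCutSize 1) *
        (max I.m 1 * max I.n 1 ^ 3) := by ring
    _ ≤ 102000 * (2 ^ (I.minCutSize * (I.minCutSize + 2)) * max I.minCutSize 1) *
        ((I.n + I.m + 1) * (I.n + I.m + 1) ^ 3) := by gcongr
    _ = _ := by ring
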